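/- Let $(M,g)$ be a smooth finite-dimensional Riemannian manifold (without boundary) that is flat, i.e. whose curvature tensor vanishes identically, and let $f:M\to(0,\infty)$ be a smooth function. For a point $(x,u)\in TM$ and $X\in T_xM$ let $X^V,X^H\in T_{(x,u)}TM$ be the vertical and horizontal lifts of $X$; in coordinates $(x^i,y^i)$ of $TM$ induced by coordinates of $M$, with $\Gamma_{ij}^k$ the Christoffel symbols of $g$, $X^V=X^i\,\partial/\partial y^i$ and $X^H=X^i(\partial/\partial x^i-\Gamma_{ij}^k u^j\,\partial/\partial y^k)$. Let $\widehat g$ be the Sasaki metric and $g^f$ the Mus-Gradient metric on $TM$, given by $$\widehat g(X^H,Y^H)=g^f(X^H,Y^H)=g(X,Y),\qquad \widehat g(X^H,Y^V)=g^f(X^H,Y^V)=0,$$ $$\widehat g(X^V,Y^V)=g(X,Y),\qquad g^f(X^V,Y^V)=g(X,Y)+X(f)\,Y(f).$$ Denote by $\tau(\varphi)=\mathrm{Tr}\,\nabla d\varphi$ the tension field of a smooth map $\varphi$ between Riemannian manifolds, and call $\varphi$ harmonic if $\tau(\varphi)=0$. Then the tension field of the identity map $\mathrm{Id}:(TM,g^f)\to(TM,\widehat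 g)$ is $$\tau(\mathrm{Id})=\frac{\|\mathrm{grad} f\|}{1+\|\mathrm{grad} f\|^2}\,\bigl(\mathrm{grad}\,\|\mathrm{grad} f\|\bigr)^H .$$ Here $\|\mathrm{grad} f\|$ is differentiable wherever $\mathrm{grad} f\neq 0$, and at points over zeros of $\mathrm{grad} f$ the right-hand side is understood to be $0$. If moreover $M$ is connected, then this identity map is harmonic if and only if $\|\mathrm{grad} f\|$ is constant on $M$. -/

import Mathlib

set_option maxSynthPendingDepth 3

open scoped Manifold ContDiff
open Bundle

noncomputable section

namespace MusGradient

section General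

variable {E : Type*} [NormedAddCommGroup E] [NormedSpace ℝ E]
  {H : Type*} [TopologicalSpace H] (I : ModelWithCorners ℝ E H)
  (M : Type*) [TopologicalSpace M] [ChartedSpace H M]

/-- A field of bilinear forms on the tangent spaces of `M` (a covariant `2`-tensor field).
The objects below are meant for Riemannian metrics on manifolds without boundary. Recall that
`TangentSpace I p` is the model space `E`, identified with the tangent space through the
preferred chart `extChartAt I p`, whose derivative at `p` is therefore the identity of `E`. -/
abbrev MetricField : Type _ :=
  (p : M) → TangentSpace I p →L[ℝ] TangentSpace I p →L[ℝ] ℝ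

variable {I M}

/-- The components of `G` in the preferred chart at `p`: the bilinear form on `E` obtained by
pulling `G` back under the inverse of that chart, at the point `e` of the chart domain in `E`. -/
def chartMetric (G : MetricField I M) (p : M) (e : E) : E →L[ℝ] E →L[ℝ] ℝ :=
  let D : E →L[ℝ] E := mfderiv 𝓘(ℝ, E) I (extChartAt I p).symm e
  let B : E →L[ℝ] E →L[ℝ] ℝ := G ((extChartAt I p).symm e)
  B.bilinearComp D D

/-- The Christoffel symbols of the first kind of `G` in the preferred chart at `p`:
`(v, w, z) ↦ (∂_v G(w, z) + ∂_w G(v, z) - ∂_z G(v, w)) / 2`. -/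
def christoffelFirst (G : MetricField I M) (p : M) (e : E) : E →L[ℝ] E →L[ℝ] E →L[ℝ] ℝ :=
  let dG : E →L[ℝ] E →L[ℝ] E →L[ℝ] ℝ := fderiv ℝ (chartMetric G p) e
  (1 / 2 : ℝ) • (dG + dG.flip
    - ((ContinuousLinearMap.flipₗᵢ ℝ E E ℝ : (E →L[ℝ] E →L[ℝ] ℝ) →L[ℝ] (E →L[ℝ] E →L[ℝ] ℝ)) ∘L
        dG.flip))

theorem christoffelFirst_apply (G : MetricField I M) (p : M) (e v w z : E) :
    christoffelFirst G p e v w z =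
      (1 / 2 : ℝ) * (fderiv ℝ (chartMetric G p) e v w z + fderiv ℝ (chartMetric G p) e w v z
        - fderiv ℝ (chartMetric G p) e z v w) := rfl

/-- The Christoffel symbols `Γ(v, w) = v^i w^j Γ_{ij}^k ∂_k` of the Levi-Civita connection of `G`
in the preferred chart at `p`. Here `ContinuousLinearMap.inverse` inverts the map `v ↦ G(v, ·)`
from `E` to its dual, that is, it raises an index. -/
def christoffel (G : MetricField I M) (p : M) (e : E) : E →L[ℝ] E →L[ℝ] E :=
  (ContinuousLinearMap.compL ℝ E (E →L[ℝ] ℝ) E (chartMetric G p e).inverse) ∘L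
    christoffelFirst G p e

theorem christoffel_apply (G : MetricField I M) (p : M) (e v w : E) :
    christoffel G p e v w = (chartMetric G p e).inverse (christoffelFirst G p e v w) := rfl

/-- The Riemann curvature `R(u, v) w` of `G` at `p`, computed in the preferred chart at `p`. -/
def curvature (G : MetricField I M) (p : M) (u v w : TangentSpace I p) : TangentSpace I p :=
  let e : E := extChartAt I p p
  let Γ : E → E →L[ℝ] E →L[ℝ] E := christoffel G p
  let dΓ : E →L[ℝ] E →L[ℝ] E →L[ℝ] E := fderiv ℝ Γ e
  (dΓ u v w - dΓ v u w + Γ e u (Γ e v w) - Γ e v (Γ e u w) : E)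

/-- `G` is flat: its curvature tensor vanishes identically. -/
def IsFlat (G : MetricField I M) : Prop :=
  ∀ (p : M) (u v w : TangentSpace I p), curvature G p u v w = 0

/-- The gradient of a function with respect to `G`: the vector with `G(grad φ, ·) = dφ`. -/
def grad (G : MetricField I M) (φ : M → ℝ) (p : M) : TangentSpace I p :=
  (G p).inverse (mfderiv I 𝓘(ℝ, ℝ) φ p)

/-- The function `‖grad φ‖`, the norm being that of `G`. -/
def gradNorm (G : MetricField I M) (φ : M → ℝ) (p : M) : ℝ :=
  √(G p (grad G φ p) (grad G φ p))

variable {E' : Type*} [NormedAddCommGroup E'] [NormedSpace ℝ E']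
  {H' : Type*} [TopologicalSpace H'] {J : ModelWithCorners ℝ E' H'}
  {N : Type*} [TopologicalSpace N] [ChartedSpace H' N]

/-- The second fundamental form `∇dφ` at `p` of a map `φ : (M, G) → (N, K)`, in the preferred
charts at `p` and `φ p`:
`∇dφ(v, w) = D²φ(v, w) - Dφ(Γ^G(v, w)) + Γ^K(Dφ v, Dφ w)`. -/
def secondFundamentalForm (G : MetricField I M) (K : MetricField J N) (φ : M → N) (p : M)
    (v w : TangentSpace I p) : TangentSpace J (φ p) :=
  let e : E := extChartAt I p p
  let φ' : E → E' := writtenInExtChartAt I J p φ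
  let dφ : E →L[ℝ] E' := fderiv ℝ φ' e
  (fderiv ℝ (fderiv ℝ φ') e v w - dφ (christoffel G p e v w)
    + christoffel K (φ p) (extChartAt J (φ p) (φ p)) (dφ v) (dφ w) : E')

/-- The tension field `τ(φ) = Tr_G ∇dφ`. With a basis `b i` of the tangent space and its dual
basis `b^i`, the trace of a bilinear map `B` is `∑ i, B (b i, (b^i)^♯) = ∑ i j, G^{ij} B(b i, b j)`;
it does not depend on the basis. -/
def tension [FiniteDimensional ℝ E] (G : MetricField I M) (K : MetricField J N) (φ : M → N)
    (p : M) : TangentSpace J (φ p) :=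
  let b := Module.finBasis ℝ E
  ∑ i, secondFundamentalForm G K φ p (b i)
    ((G p).inverse (LinearMap.toContinuousLinearMap (b.coord i) : E →L[ℝ] ℝ))

/-- A smooth map is harmonic when its tension field vanishes identically. -/
def IsHarmonic [FiniteDimensional ℝ E] (G : MetricField I M) (K : MetricField J N)
    (φ : M → N) : Prop :=
  ContMDiff I J ∞ φ ∧ ∀ p, tension G K φ p = 0

end General

section TangentBundle

variable {E : Type*} [NormedAddCommGroup E] [NormedSpace ℝ E]
  {M : Type*} [TopologicalSpace M] [ChartedSpace E M] [IsManifold 𝓘(ℝ, E) ∞ M]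

/-- The horizontal lift of `a` to the point `p = (x, u)` of `TM`: in the chart `(x^i, y^i)` induced
by the preferred chart at `x` it is `a^i (∂/∂x^i - Γ_{ij}^k u^j ∂/∂y^k)`. -/
def horizontalLift (g : MetricField 𝓘(ℝ, E) M) (p : TangentBundle 𝓘(ℝ, E) M)
    (a : TangentSpace 𝓘(ℝ, E) p.proj) : TangentSpace 𝓘(ℝ, E).tangent p :=
  ((a, - christoffel g p.proj (extChartAt 𝓘(ℝ, E) p.proj p.proj) a p.2) : E × E)

/-- The vertical lift `a^i ∂/∂y^i` of `a` to the point `p = (x, u)` of `TM`. -/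
def verticalLift (p : TangentBundle 𝓘(ℝ, E) M)
    (a : TangentSpace 𝓘(ℝ, E) p.proj) : TangentSpace 𝓘(ℝ, E).tangent p :=
  (((0 : E), (a : E)) : E × E)

/-- The differential of the projection `TM → M` at `p`; it sends `X^H + Y^V` to `X`. -/
def horizontalPart (_p : TangentBundle 𝓘(ℝ, E) M) : E × E →L[ℝ] E :=
  ContinuousLinearMap.fst ℝ E E

/-- The connection map at `p = (x, u)`; it sends `X^H + Y^V` to `Y`, that is,
`(a, b) ↦ b + Γ(a, u)`. -/
def verticalPart (g : MetricField 𝓘(ℝ, E) M) (p : TangentBundle 𝓘(ℝ, E) M) : E × E →L[ℝ] E :=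
  ContinuousLinearMap.snd ℝ E E +
    ((christoffel g p.proj (extChartAt 𝓘(ℝ, E) p.proj p.proj)).flip p.2) ∘L
      ContinuousLinearMap.fst ℝ E E

/-- The Sasaki metric on `TM`. -/
def sasaki (g : MetricField 𝓘(ℝ, E) M) :
    MetricField 𝓘(ℝ, E).tangent (TangentBundle 𝓘(ℝ, E) M) := fun p =>
  let B : E →L[ℝ] E →L[ℝ] ℝ := g p.proj
  (B.bilinearComp (horizontalPart p) (horizontalPart p)
    + B.bilinearComp (verticalPart g p) (verticalPart g p) : E × E →L[ℝ] E × E →L[ℝ] ℝ)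

/-- The Mus-Gradient metric `g^f` on `TM`. -/
def musGradient (g : MetricField 𝓘(ℝ, E) M) (f : M → ℝ) :
    MetricField 𝓘(ℝ, E).tangent (TangentBundle 𝓘(ℝ, E) M) := fun p =>
  let B : E →L[ℝ] E →L[ℝ] ℝ := g p.proj
  let df : E →L[ℝ] ℝ := mfderiv 𝓘(ℝ, E) 𝓘(ℝ, ℝ) f p.proj
  (B.bilinearComp (horizontalPart p) (horizontalPart p)
    + B.bilinearComp (verticalPart g p) (verticalPart g p)
    + (df ∘L verticalPart g p).smulRight (df ∘L verticalPart g p) :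
      E × E →L[ℝ] E × E →L[ℝ] ℝ)

/-- Every tangent vector of `TM` is the sum of a horizontal and a vertical lift. -/
theorem eq_horizontalLift_add_verticalLift (g : MetricField 𝓘(ℝ, E) M)
    (p : TangentBundle 𝓘(ℝ, E) M) (ξ : TangentSpace 𝓘(ℝ, E).tangent p) :
    ξ = horizontalLift g p (horizontalPart p ξ) + verticalLift p (verticalPart g p ξ) := by
  refine Prod.ext (add_zero (ξ : E × E).1).symm ?_
  exact (neg_add_cancel_comm_assoc
    (christoffel g p.proj (extChartAt 𝓘(ℝ, E) p.proj p.proj) (ξ : E × E).1 p.2)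
    (ξ : E × E).2).symm

theorem horizontalPart_horizontalLift (g : MetricField 𝓘(ℝ, E) M) (p : TangentBundle 𝓘(ℝ, E) M)
    (a : TangentSpace 𝓘(ℝ, E) p.proj) : horizontalPart p (horizontalLift g p a) = a := rfl

theorem horizontalPart_verticalLift (p : TangentBundle 𝓘(ℝ, E) M)
    (a : TangentSpace 𝓘(ℝ, E) p.proj) : horizontalPart p (verticalLift p a) = 0 := rfl

theorem verticalPart_horizontalLift (g : MetricField 𝓘(ℝ, E) M) (p : TangentBundle 𝓘(ℝ, E) M)
    (a : TangentSpace 𝓘(ℝ, E) p.proj) : verticalPart g p (horizontalLift g p a) = 0 :=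
  neg_add_cancel (christoffel g p.proj (extChartAt 𝓘(ℝ, E) p.proj p.proj) a p.2)

theorem verticalPart_verticalLift (g : MetricField 𝓘(ℝ, E) M) (p : TangentBundle 𝓘(ℝ, E) M)
    (a : TangentSpace 𝓘(ℝ, E) p.proj) : verticalPart g p (verticalLift p a) = a := by
  have key : ∀ (L : E →L[ℝ] E →L[ℝ] E) (u b : E), b + L 0 u = b := fun L u b => by simp
  exact key (christoffel g p.proj (extChartAt 𝓘(ℝ, E) p.proj p.proj)) p.2 a

theorem sasaki_apply (g : MetricField 𝓘(ℝ, E) M) (p : TangentBundle 𝓘(ℝ, E) M)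
    (ξ η : TangentSpace 𝓘(ℝ, E).tangent p) :
    sasaki g p ξ η = g p.proj (horizontalPart p ξ) (horizontalPart p η)
      + g p.proj (verticalPart g p ξ) (verticalPart g p η) := rfl

theorem musGradient_apply (g : MetricField 𝓘(ℝ, E) M) (f : M → ℝ)
    (p : TangentBundle 𝓘(ℝ, E) M) (ξ η : TangentSpace 𝓘(ℝ, E).tangent p) :
    let df : E →L[ℝ] ℝ := mfderiv 𝓘(ℝ, E) 𝓘(ℝ, ℝ) f p.proj
    musGradient g f p ξ η = g p.proj (horizontalPart p ξ) (horizontalPart p η)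
      + g p.proj (verticalPart g p ξ) (verticalPart g p η)
      + df (verticalPart g p ξ) * df (verticalPart g p η) := rfl

end TangentBundle

end MusGradient

end

noncomputable section

namespace MusGradient

section LocalGeometry

variable {F : Type*} [NormedAddCommGroup F] [NormedSpace ℝ F]

/-- The Christoffel symbols of the first kind of a metric on an open subset of a vector space. -/
def localChristoffelFirst (K : F → F →L[ℝ] F →L[ℝ] ℝ) (e : F) : F →L[ℝ] F →L[ℝ] F →L[ℝ] ℝ :=
  let dK : F →L[ℝ] F →L[ℝ] F →L[ℝ] ℝ := fderiv ℝ K e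
  (1 / 2 : ℝ) • (dK + dK.flip
    - ((ContinuousLinearMap.flipₗᵢ ℝ F F ℝ : (F →L[ℝ] F →L[ℝ] ℝ) →L[ℝ] (F →L[ℝ] F →L[ℝ] ℝ)) ∘L
        dK.flip))

/-- The Christoffel symbols of a metric on an open subset of a vector space. -/
def localChristoffel (K : F → F →L[ℝ] F →L[ℝ] ℝ) (e : F) : F →L[ℝ] F →L[ℝ] F :=
  (ContinuousLinearMap.compL ℝ F (F →L[ℝ] ℝ) F (K e).inverse) ∘L localChristoffelFirst K e

theorem localChristoffelFirst_apply (K : F → F →L[ℝ] F →L[ℝ] ℝ) (e v w z : F) :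
    localChristoffelFirst K e v w z =
      (1 / 2 : ℝ) * (fderiv ℝ K e v w z + fderiv ℝ K e w v z - fderiv ℝ K e z v w) := rfl

theorem localChristoffel_apply (K : F → F →L[ℝ] F →L[ℝ] ℝ) (e v w : F) :
    localChristoffel K e v w = (K e).inverse (localChristoffelFirst K e v w) := rfl

theorem apply_inverse_apply {A : F →L[ℝ] F →L[ℝ] ℝ} (hA : A.IsInvertible) (l : F →L[ℝ] ℝ) :
    A (A.inverse l) = l := by
  obtain ⟨A, rfl⟩ := hA
  simp

theorem inverse_apply_apply {A : F →L[ℝ] F →L[ℝ] ℝ} (hA : A.IsInvertible) (v : F) :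
    A.inverse (A v) = v := by
  obtain ⟨A, rfl⟩ := hA
  simp

theorem metric_localChristoffel {K : F → F →L[ℝ] F →L[ℝ] ℝ} {e : F} (hK : (K e).IsInvertible)
    (v w z : F) :
    K e (localChristoffel K e v w) z =
      (1 / 2 : ℝ) * (fderiv ℝ K e v w z + fderiv ℝ K e w v z - fderiv ℝ K e z v w) := by
  rw [localChristoffel_apply, apply_inverse_apply hK, localChristoffelFirst_apply]

theorem localChristoffel_congr {K K' : F → F →L[ℝ] F →L[ℝ] ℝ} {e : F}
    (h : K =ᶠ[nhds e] K') : localChristoffel K e = localChristoffel K' e := by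
  ext v w
  rw [localChristoffel_apply, localChristoffel_apply, h.eq_of_nhds]
  congr 1
  ext z
  rw [localChristoffelFirst_apply, localChristoffelFirst_apply, h.fderiv_eq]

theorem isInvertible_of_pos [FiniteDimensional ℝ F] {A : F →L[ℝ] F →L[ℝ] ℝ}
    (hA : ∀ v, v ≠ 0 → 0 < A v v) : A.IsInvertible := by
  have hinj : Function.Injective
      ((LinearMap.toContinuousLinearMap : (F →ₗ[ℝ] ℝ) ≃ₗ[ℝ] (F →L[ℝ] ℝ)).symm.toLinearMap ∘ₗ
        A.toLinearMap) := by
    rw [← LinearMap.ker_eq_bot, LinearMap.ker_eq_bot']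
    intro v hv
    by_contra hne
    have h0 : A v v = 0 := LinearMap.congr_fun hv v
    exact (hA v hne).ne' h0
  have hinj' : Function.Injective A.toLinearMap := fun a b hab => hinj (by
    simp only [LinearMap.comp_apply, hab])
  have hdim : Module.finrank ℝ F = Module.finrank ℝ (F →L[ℝ] ℝ) := by
    rw [← (LinearMap.toContinuousLinearMap : (F →ₗ[ℝ] ℝ) ≃ₗ[ℝ] (F →L[ℝ] ℝ)).finrank_eq]
    exact (Subspace.dual_finrank_eq (K := ℝ) (V := F)).symm
  refine ⟨(LinearEquiv.ofInjectiveOfFinrankEq A.toLinearMap hinj' hdim).toContinuousLinearEquiv, ?_⟩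
  ext v w
  rfl

theorem inverse_symm {A : F →L[ℝ] F →L[ℝ] ℝ} (hA : A.IsInvertible)
    (hs : ∀ v w, A v w = A w v) (l m : F →L[ℝ] ℝ) : l (A.inverse m) = m (A.inverse l) := by
  conv_lhs => rw [← apply_inverse_apply hA l]
  rw [hs, apply_inverse_apply hA]

/-- The metric trace of a bilinear form is the trace of the endomorphism obtained by raising an
index. -/
theorem sum_apply_inverse_coord [FiniteDimensional ℝ F] {ι : Type*} [Fintype ι]
    (b : Module.Basis ι ℝ F) {A : F →L[ℝ] F →L[ℝ] ℝ} (hA : A.IsInvertible)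
    (hs : ∀ v w, A v w = A w v) (T : F →L[ℝ] F →L[ℝ] ℝ) :
    ∑ i, T (b i) (A.inverse (LinearMap.toContinuousLinearMap (b.coord i) : F →L[ℝ] ℝ)) =
      LinearMap.trace ℝ F (A.inverse ∘L T).toLinearMap := by
  classical
  rw [LinearMap.trace_eq_matrix_trace ℝ b, Matrix.trace]
  refine Finset.sum_congr rfl fun i _ => ?_
  rw [inverse_symm hA hs, Matrix.diag_apply, LinearMap.toMatrix_apply]
  rfl

theorem trace_eq_zero_of_sq_eq_zero [FiniteDimensional ℝ F] (T : F →ₗ[ℝ] F)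
    (hT : ∀ v, T (T v) = 0) : LinearMap.trace ℝ F T = 0 := by
  have : IsNilpotent T := ⟨2, by ext v; simp [pow_two, hT]⟩
  exact (LinearMap.isNilpotent_trace_of_isNilpotent this).eq_zero

/-- The derivative of `x ↦ K x (X x) (Y x)`. -/
theorem fderiv_bilin_apply {D : Type*} [NormedAddCommGroup D] [NormedSpace ℝ D]
    {K : D → F →L[ℝ] F →L[ℝ] ℝ} {X Y : D → F} {z : D}
    (hK : DifferentiableAt ℝ K z) (hX : DifferentiableAt ℝ X z) (hY : DifferentiableAt ℝ Y z)
    (ξ : D) :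
    fderiv ℝ (fun x => K x (X x) (Y x)) z ξ =
      fderiv ℝ K z ξ (X z) (Y z) + K z (fderiv ℝ X z ξ) (Y z) + K z (X z) (fderiv ℝ Y z ξ) := by
  have h := ((hK.hasFDerivAt.clm_apply hX.hasFDerivAt).clm_apply hY.hasFDerivAt).fderiv
  rw [h]
  simp
  ring

theorem fderiv_apply₂ {D : Type*} [NormedAddCommGroup D] [NormedSpace ℝ D]
    {K : D → F →L[ℝ] F →L[ℝ] ℝ} {z : D} (hK : DifferentiableAt ℝ K z) (ξ : D) (v w : F) :
    fderiv ℝ K z ξ v w = fderiv ℝ (fun x => K x v w) z ξ := by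
  rw [fderiv_bilin_apply hK (differentiableAt_const _) (differentiableAt_const _)]
  simp

theorem fderiv_apply₁ {D G : Type*} [NormedAddCommGroup D] [NormedSpace ℝ D]
    [NormedAddCommGroup G] [NormedSpace ℝ G]
    {K : D → F →L[ℝ] G} {z : D} (hK : DifferentiableAt ℝ K z) (ξ : D) (v : F) :
    fderiv ℝ K z ξ v = fderiv ℝ (fun x => K x v) z ξ := by
  rw [(hK.hasFDerivAt.clm_apply (hasFDerivAt_const v z)).fderiv]
  simp

/-- The difference of the Christoffel symbols of `K` and of `G = K + θ ⊗ θ`. -/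
theorem metric_christoffel_sub {K : F → F →L[ℝ] F →L[ℝ] ℝ} {θ : F → F →L[ℝ] ℝ} {z : F}
    (hK : DifferentiableAt ℝ K z) (hθ : DifferentiableAt ℝ θ z)
    (hKi : (K z).IsInvertible) (hGi : (K z + (θ z).smulRight (θ z)).IsInvertible) (v w ζ : F) :
    (K z + (θ z).smulRight (θ z))
      (localChristoffel K z v w - localChristoffel (fun x => K x + (θ x).smulRight (θ x)) z v w) ζ =
    θ z ζ * (θ z (localChristoffel K z v w) - (1 / 2) * (fderiv ℝ θ z v w + fderiv ℝ θ z w v))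
      - (1 / 2) * (θ z w * (fderiv ℝ θ z v ζ - fderiv ℝ θ z ζ v)
        + θ z v * (fderiv ℝ θ z w ζ - fderiv ℝ θ z ζ w)) := by
  have hd : ∀ ξ a b, fderiv ℝ (fun x => K x + (θ x).smulRight (θ x)) z ξ a b =
      fderiv ℝ K z ξ a b + fderiv ℝ θ z ξ a * θ z b + θ z a * fderiv ℝ θ z ξ b := by
    intro ξ a b
    have hr : DifferentiableAt ℝ (fun x => (θ x).smulRight (θ x)) z :=
      ((ContinuousLinearMap.smulRightL ℝ F (F →L[ℝ] ℝ)).differentiableAt.comp z hθ).clm_apply hθ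
    rw [fderiv_fun_add hK hr, add_apply, add_apply,
      add_apply, fderiv_apply₂ hr]
    simp only [ContinuousLinearMap.smulRight_apply, smul_apply, smul_eq_mul]
    rw [((hθ.hasFDerivAt.clm_apply (hasFDerivAt_const a z)).fun_mul
      (hθ.hasFDerivAt.clm_apply (hasFDerivAt_const b z))).fderiv]
    simp
    ring
  rw [map_sub, sub_apply, metric_localChristoffel (K := fun x =>
    K x + (θ x).smulRight (θ x)) hGi, hd, hd, hd, add_apply,
    add_apply, metric_localChristoffel hKi]
  simp only [ContinuousLinearMap.smulRight_apply, smul_apply, smul_eq_mul]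
  ring

end LocalGeometry

section LocalTangentBundle

theorem _root_.DifferentiableAt.clm_flip {D E₁ E₂ F : Type*} [NormedAddCommGroup D]
    [NormedSpace ℝ D] [NormedAddCommGroup E₁] [NormedSpace ℝ E₁] [NormedAddCommGroup E₂]
    [NormedSpace ℝ E₂] [NormedAddCommGroup F] [NormedSpace ℝ F] {A : D → E₁ →L[ℝ] E₂ →L[ℝ] F}
    {z : D} (hA : DifferentiableAt ℝ A z) : DifferentiableAt ℝ (fun x => (A x).flip) z :=
  (ContinuousLinearMap.flipₗᵢ ℝ E₁ E₂ F).differentiableAt.comp z hA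

theorem _root_.DifferentiableAt.clm_bilinearComp {D E F : Type*} [NormedAddCommGroup D]
    [NormedSpace ℝ D] [NormedAddCommGroup E] [NormedSpace ℝ E] [NormedAddCommGroup F]
    [NormedSpace ℝ F] {A : D → E →L[ℝ] E →L[ℝ] ℝ} {P Q : D → F →L[ℝ] E} {z : D}
    (hA : DifferentiableAt ℝ A z) (hP : DifferentiableAt ℝ P z) (hQ : DifferentiableAt ℝ Q z) :
    DifferentiableAt ℝ (fun x => (A x).bilinearComp (P x) (Q x)) z :=
  ((hA.clm_comp hP).clm_flip.clm_comp hQ).clm_flip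

variable {E : Type*} [NormedAddCommGroup E] [NormedSpace ℝ E]

/-- The connection map `(a, b) ↦ b + Γ(a, u)` at the point `(x, u)` of `E × E`. -/
def connectionMap (Γ : E → E →L[ℝ] E →L[ℝ] E) (z : E × E) : E × E →L[ℝ] E :=
  ContinuousLinearMap.snd ℝ E E + ((Γ z.1).flip z.2) ∘L ContinuousLinearMap.fst ℝ E E

/-- The Sasaki metric on `E × E` of the metric `B`. -/
def localSasaki (B : E → E →L[ℝ] E →L[ℝ] ℝ) (Γ : E → E →L[ℝ] E →L[ℝ] E) (z : E × E) :
    E × E →L[ℝ] E × E →L[ℝ] ℝ :=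
  (B z.1).bilinearComp (ContinuousLinearMap.fst ℝ E E) (ContinuousLinearMap.fst ℝ E E)
    + (B z.1).bilinearComp (connectionMap Γ z) (connectionMap Γ z)

/-- The Mus-Gradient metric on `E × E` of the metric `B` and a function with differential `η`. -/
def localMusGradient (B : E → E →L[ℝ] E →L[ℝ] ℝ) (Γ : E → E →L[ℝ] E →L[ℝ] E) (η : E → E →L[ℝ] ℝ)
    (z : E × E) : E × E →L[ℝ] E × E →L[ℝ] ℝ :=
  localSasaki B Γ z +
    (η z.1 ∘L connectionMap Γ z).smulRight (η z.1 ∘L connectionMap Γ z)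

variable {B : E → E →L[ℝ] E →L[ℝ] ℝ} {Γ : E → E →L[ℝ] E →L[ℝ] E} {η : E → E →L[ℝ] ℝ} {z : E × E}

theorem connectionMap_apply (v : E × E) : connectionMap Γ z v = v.2 + Γ z.1 v.1 z.2 := rfl

theorem localSasaki_apply (v w : E × E) : localSasaki B Γ z v w =
    B z.1 v.1 w.1 + B z.1 (connectionMap Γ z v) (connectionMap Γ z w) := rfl

theorem localMusGradient_apply (v w : E × E) : localMusGradient B Γ η z v w =
    B z.1 v.1 w.1 + B z.1 (connectionMap Γ z v) (connectionMap Γ z w)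
      + η z.1 (connectionMap Γ z v) * η z.1 (connectionMap Γ z w) := rfl

theorem connectionMap_vertical (c : E) : connectionMap Γ z (0, c) = c := by
  simp [connectionMap_apply]

theorem connectionMap_horizontal (a : E) : connectionMap Γ z (a, -Γ z.1 a z.2) = 0 := by
  simp [connectionMap_apply]

theorem differentiableAt_connectionMap (hΓ : DifferentiableAt ℝ Γ z.1) :
    DifferentiableAt ℝ (connectionMap Γ) z :=
  ((((hΓ.comp z differentiableAt_fst).clm_flip).clm_apply differentiableAt_snd).clm_comp
    (differentiableAt_const _)).const_add _

theorem differentiableAt_localSasaki (hB : DifferentiableAt ℝ B z.1)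
    (hΓ : DifferentiableAt ℝ Γ z.1) : DifferentiableAt ℝ (localSasaki B Γ) z :=
  have h := hB.comp z differentiableAt_fst
  (h.clm_bilinearComp (differentiableAt_const _) (differentiableAt_const _)).add
    (h.clm_bilinearComp (differentiableAt_connectionMap hΓ) (differentiableAt_connectionMap hΓ))

theorem fderiv_comp_fst {G : Type*} [NormedAddCommGroup G] [NormedSpace ℝ G] {A : E → G}
    (hA : DifferentiableAt ℝ A z.1) (ξ : E × E) :
    fderiv ℝ (fun x : E × E => A x.1) z ξ = fderiv ℝ A z.1 ξ.1 := by
  have h : HasFDerivAt (fun x : E × E => A x.1) _ z := hA.hasFDerivAt.comp z hasFDerivAt_fst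
  rw [h.fderiv]
  rfl

theorem fderiv_connectionMap_vertical (hΓ : DifferentiableAt ℝ Γ z.1) (m : E) (v : E × E) :
    fderiv ℝ (connectionMap Γ) z (0, m) v = Γ z.1 v.1 m := by
  rw [fderiv_apply₁ (differentiableAt_connectionMap hΓ)]
  have h : HasFDerivAt (fun x : E × E => connectionMap Γ x v) _ z :=
    (((((hΓ.hasFDerivAt.comp z hasFDerivAt_fst).clm_apply (hasFDerivAt_const v.1 z)).clm_apply
      hasFDerivAt_snd)).const_add v.2)
  rw [h.fderiv]
  simp

theorem fderiv_connectionMap_apply_vertical (hΓ : DifferentiableAt ℝ Γ z.1) (ξ : E × E) (c : E) :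
    fderiv ℝ (connectionMap Γ) z ξ (0, c) = 0 := by
  rw [fderiv_apply₁ (differentiableAt_connectionMap hΓ)]
  simp [connectionMap_vertical]

theorem fderiv_localSasaki (hB : DifferentiableAt ℝ B z.1) (hΓ : DifferentiableAt ℝ Γ z.1)
    (ξ v w : E × E) :
    fderiv ℝ (localSasaki B Γ) z ξ v w = fderiv ℝ B z.1 ξ.1 v.1 w.1
      + fderiv ℝ B z.1 ξ.1 (connectionMap Γ z v) (connectionMap Γ z w)
      + B z.1 (fderiv ℝ (connectionMap Γ) z ξ v) (connectionMap Γ z w)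
      + B z.1 (connectionMap Γ z v) (fderiv ℝ (connectionMap Γ) z ξ w) := by
  have hB' : DifferentiableAt ℝ (fun x : E × E => B x.1) z := hB.comp z differentiableAt_fst
  have hV := differentiableAt_connectionMap hΓ
  have hV' : ∀ v, DifferentiableAt ℝ (fun x => connectionMap Γ x v) z := fun v =>
    hV.clm_apply (differentiableAt_const v)
  rw [fderiv_apply₂ (differentiableAt_localSasaki hB hΓ)]
  simp only [localSasaki_apply]
  rw [fderiv_fun_add ((hB'.clm_apply (differentiableAt_const _)).clm_apply
      (differentiableAt_const _)) ((hB'.clm_apply (hV' v)).clm_apply (hV' w)), add_apply,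
    ← fderiv_apply₂ hB', fderiv_bilin_apply hB' (hV' v) (hV' w), fderiv_comp_fst hB,
    ← fderiv_apply₁ hV, ← fderiv_apply₁ hV]
  ring

theorem differentiableAt_comp_connectionMap (hη : DifferentiableAt ℝ η z.1)
    (hΓ : DifferentiableAt ℝ Γ z.1) :
    DifferentiableAt ℝ (fun x => η x.1 ∘L connectionMap Γ x) z :=
  (hη.comp z differentiableAt_fst).clm_comp (differentiableAt_connectionMap hΓ)

theorem fderiv_comp_connectionMap (hη : DifferentiableAt ℝ η z.1) (hΓ : DifferentiableAt ℝ Γ z.1)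
    (ξ v : E × E) :
    fderiv ℝ (fun x => η x.1 ∘L connectionMap Γ x) z ξ v =
      fderiv ℝ η z.1 ξ.1 (connectionMap Γ z v) + η z.1 (fderiv ℝ (connectionMap Γ) z ξ v) := by
  have hη' : DifferentiableAt ℝ (fun x : E × E => η x.1) z := hη.comp z differentiableAt_fst
  have hV := differentiableAt_connectionMap hΓ
  rw [(hη'.hasFDerivAt.clm_comp hV.hasFDerivAt).fderiv]
  simp [fderiv_comp_fst hη]
  ring

theorem localSasaki_pos (hpos : ∀ v, v ≠ 0 → 0 < B z.1 v v) (v : E × E) (hv : v ≠ 0) :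
    0 < localSasaki B Γ z v v := by
  have hnn : ∀ v, 0 ≤ B z.1 v v := fun v => by
    rcases eq_or_ne v 0 with rfl | h
    · simp
    · exact (hpos v h).le
  rw [localSasaki_apply]
  rcases eq_or_ne v.1 0 with h | h
  · have h2 : v.2 ≠ 0 := fun h2 => hv (Prod.ext h h2)
    have : connectionMap Γ z v = v.2 := by simp [connectionMap_apply, h]
    rw [this]
    linarith [hnn v.1, hpos _ h2]
  · linarith [hnn (connectionMap Γ z v), hpos _ h]

theorem localMusGradient_pos (hpos : ∀ v, v ≠ 0 → 0 < B z.1 v v) (v : E × E) (hv : v ≠ 0) :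
    0 < localMusGradient B Γ η z v v := by
  have h : 0 < localSasaki B Γ z v v := localSasaki_pos hpos v hv
  rw [localSasaki_apply] at h
  rw [localMusGradient_apply]
  linarith [mul_self_nonneg (η z.1 (connectionMap Γ z v))]

theorem localMusGradient_symm (hs : ∀ v w, B z.1 v w = B z.1 w v) (v w : E × E) :
    localMusGradient B Γ η z v w = localMusGradient B Γ η z w v := by
  rw [localMusGradient_apply, localMusGradient_apply, hs v.1, hs (connectionMap Γ z v)]
  ring

/-- The covariant derivative `(a, c) ↦ (∇_a η)(c)`. -/
def covariantDerivative (Γ : E → E →L[ℝ] E →L[ℝ] E) (η : E → E →L[ℝ] ℝ) (e : E) :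
    E →L[ℝ] E →L[ℝ] ℝ :=
  fderiv ℝ η e - (ContinuousLinearMap.compL ℝ E E ℝ (η e)) ∘L Γ e

theorem covariantDerivative_apply (e a c : E) :
    covariantDerivative Γ η e a c = fderiv ℝ η e a c - η e (Γ e a c) := rfl

theorem metric_compatible {e : E} (hi : (B e).IsInvertible) (hs : ∀ v w, B e v w = B e w v)
    (hds : ∀ a v w, fderiv ℝ B e a v w = fderiv ℝ B e a w v) (a v w : E) :
    fderiv ℝ B e a v w =
      B e (localChristoffel B e a v) w + B e v (localChristoffel B e a w) := by
  rw [hs v, metric_localChristoffel hi, metric_localChristoffel hi]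
  linarith [hds a v w, hds v a w, hds w v a]

variable [FiniteDimensional ℝ E]

/-- The symmetrized Sasaki covariant derivative of the pull-back of `η` under the connection
map. -/
theorem symm_covariantDerivative_comp_connectionMap (hB : DifferentiableAt ℝ B z.1)
    (hpos : ∀ v, v ≠ 0 → 0 < B z.1 v v) (hs : ∀ v w, B z.1 v w = B z.1 w v)
    (hds : ∀ a v w, fderiv ℝ B z.1 a v w = fderiv ℝ B z.1 a w v)
    (hΓ : DifferentiableAt ℝ Γ z.1) (hΓB : Γ z.1 = localChristoffel B z.1)
    (hη : DifferentiableAt ℝ η z.1) (v w : E × E) :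
    (η z.1 ∘L connectionMap Γ z) (localChristoffel (localSasaki B Γ) z v w)
      - (1 / 2) * (fderiv ℝ (fun x => η x.1 ∘L connectionMap Γ x) z v w
        + fderiv ℝ (fun x => η x.1 ∘L connectionMap Γ x) z w v) =
    -(1 / 2) * (covariantDerivative Γ η z.1 v.1 (connectionMap Γ z w)
      + covariantDerivative Γ η z.1 w.1 (connectionMap Γ z v)) := by
  have hi := isInvertible_of_pos hpos
  have hKi : (localSasaki B Γ z).IsInvertible := isInvertible_of_pos (localSasaki_pos hpos)
  obtain ⟨n, hn⟩ : ∃ n, n = (B z.1).inverse (η z.1) := ⟨_, rfl⟩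
  have hBn : ∀ c, B z.1 c n = η z.1 c := fun c => by
    rw [hs, hn, apply_inverse_apply hi]
  have hk : ∀ k, (η z.1 ∘L connectionMap Γ z) k = localSasaki B Γ z k (0, n) := fun k => by
    rw [localSasaki_apply, connectionMap_vertical, hBn]
    simp
  have hmc := metric_compatible hi hs hds
  rw [← hΓB] at hmc
  rw [hk, metric_localChristoffel hKi, fderiv_comp_connectionMap hη hΓ,
    fderiv_comp_connectionMap hη hΓ]
  simp only [fderiv_localSasaki hB hΓ, connectionMap_vertical, fderiv_connectionMap_vertical hΓ,
    fderiv_connectionMap_apply_vertical hΓ, hBn, covariantDerivative_apply, hmc, map_zero, zero_apply,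
    hs _ (Γ z.1 w.1 n), hs _ (Γ z.1 v.1 n)]
  ring

end LocalTangentBundle

section LocalTension

variable {E : Type*} [NormedAddCommGroup E] [NormedSpace ℝ E] [FiniteDimensional ℝ E]
  {B : E → E →L[ℝ] E →L[ℝ] ℝ} {Γ : E → E →L[ℝ] E →L[ℝ] E} {η : E → E →L[ℝ] ℝ} {z : E × E}

theorem sum_rankOne_apply_inverse_coord {F ι : Type*} [NormedAddCommGroup F] [NormedSpace ℝ F]
    [FiniteDimensional ℝ F] [Fintype ι] (b : Module.Basis ι ℝ F) {A : F →L[ℝ] F →L[ℝ] ℝ}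
    (hA : A.IsInvertible) (hs : ∀ v w, A v w = A w v) (l m : F →L[ℝ] ℝ) :
    ∑ i, l (b i) * m (A.inverse (LinearMap.toContinuousLinearMap (b.coord i) : F →L[ℝ] ℝ)) =
      l (A.inverse m) := by
  conv_rhs => rw [← b.sum_repr (A.inverse m), map_sum]
  refine Finset.sum_congr rfl fun i _ => ?_
  rw [inverse_symm hA hs, map_smul, smul_eq_mul, mul_comm]
  rfl

theorem fst_localMusGradient_inverse (hpos : ∀ v, v ≠ 0 → 0 < B z.1 v v) (l : E →L[ℝ] ℝ) :
    ((localMusGradient B Γ η z).inverse (l ∘L connectionMap Γ z)).1 = 0 := by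
  obtain ⟨X, hX⟩ : ∃ X, X = (localMusGradient B Γ η z).inverse (l ∘L connectionMap Γ z) := ⟨_, rfl⟩
  rw [← hX]
  by_contra h
  have h1 : localMusGradient B Γ η z X (X.1, -Γ z.1 X.1 z.2) = 0 := by
    rw [hX, apply_inverse_apply (isInvertible_of_pos (localMusGradient_pos hpos)), ← hX,
      ContinuousLinearMap.comp_apply, connectionMap_horizontal, map_zero]
  rw [localMusGradient_apply, connectionMap_horizontal] at h1
  simp only [map_zero, mul_zero, add_zero] at h1
  exact (hpos _ h).ne' h1

theorem connectionMap_localMusGradient_inverse (hpos : ∀ v, v ≠ 0 → 0 < B z.1 v v)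
    (l : E →L[ℝ] ℝ) : connectionMap Γ z
      ((localMusGradient B Γ η z).inverse (l ∘L ContinuousLinearMap.fst ℝ E E)) = 0 := by
  obtain ⟨X, hX⟩ : ∃ X, X =
    (localMusGradient B Γ η z).inverse (l ∘L ContinuousLinearMap.fst ℝ E E) := ⟨_, rfl⟩
  rw [← hX]
  by_contra h
  have h1 : localMusGradient B Γ η z X (0, connectionMap Γ z X) = 0 := by
    rw [hX, apply_inverse_apply (isInvertible_of_pos (localMusGradient_pos hpos)), ← hX]
    simp
  rw [localMusGradient_apply, connectionMap_vertical] at h1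
  simp only [map_zero, zero_add] at h1
  linarith [hpos _ h, mul_self_nonneg (η z.1 (connectionMap Γ z X))]

/-- The vector dual to the pull-back of `η` under the connection map. -/
theorem localMusGradient_inverse_comp_connectionMap (hpos : ∀ v, v ≠ 0 → 0 < B z.1 v v) :
    (localMusGradient B Γ η z).inverse (η z.1 ∘L connectionMap Γ z) =
      (0, (1 + η z.1 ((B z.1).inverse (η z.1)))⁻¹ • (B z.1).inverse (η z.1)) := by
  have hi := isInvertible_of_pos hpos
  obtain ⟨n, hn⟩ : ∃ n, n = (B z.1).inverse (η z.1) := ⟨_, rfl⟩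
  have hBn : B z.1 n = η z.1 := by rw [hn, apply_inverse_apply hi]
  have hnn : 0 ≤ η z.1 n := by
    rw [← hBn]
    rcases eq_or_ne n 0 with h | h
    · simp [h]
    · exact (hpos n h).le
  rw [← hn, ← inverse_apply_apply (isInvertible_of_pos (localMusGradient_pos (Γ := Γ) (η := η) hpos))
    (0, (1 + η z.1 n)⁻¹ • n)]
  congr 1
  refine ContinuousLinearMap.ext fun v => ?_
  rw [localMusGradient_apply, connectionMap_vertical]
  simp only [map_zero, zero_apply, map_smul, smul_apply, hBn, ContinuousLinearMap.comp_apply,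
    smul_eq_mul]
  field_simp
  ring

theorem sum_covariantDerivative_connectionMap_right {ι : Type*} [Fintype ι]
    (b : Module.Basis ι ℝ (E × E)) (hpos : ∀ v, v ≠ 0 → 0 < B z.1 v v)
    (hs : ∀ v w, B z.1 v w = B z.1 w v) (L : E →L[ℝ] E →L[ℝ] ℝ) :
    ∑ i, L (b i).1 (connectionMap Γ z ((localMusGradient B Γ η z).inverse
      (LinearMap.toContinuousLinearMap (b.coord i) : E × E →L[ℝ] ℝ))) = 0 := by
  refine (sum_apply_inverse_coord b (isInvertible_of_pos (localMusGradient_pos hpos))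
    (localMusGradient_symm hs)
    (L.bilinearComp (ContinuousLinearMap.fst ℝ E E) (connectionMap Γ z))).trans
    (trace_eq_zero_of_sq_eq_zero _ fun v => ?_)
  have h : ∀ w, (((localMusGradient B Γ η z).inverse ∘L
      L.bilinearComp (ContinuousLinearMap.fst ℝ E E) (connectionMap Γ z)) w) =
      (localMusGradient B Γ η z).inverse (L w.1 ∘L connectionMap Γ z) := fun w => rfl
  simp only [ContinuousLinearMap.coe_coe, h, fst_localMusGradient_inverse hpos, map_zero,
    ContinuousLinearMap.zero_comp]

theorem sum_covariantDerivative_connectionMap_left {ι : Type*} [Fintype ι]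
    (b : Module.Basis ι ℝ (E × E)) (hpos : ∀ v, v ≠ 0 → 0 < B z.1 v v)
    (hs : ∀ v w, B z.1 v w = B z.1 w v) (L : E →L[ℝ] E →L[ℝ] ℝ) :
    ∑ i, L ((localMusGradient B Γ η z).inverse
      (LinearMap.toContinuousLinearMap (b.coord i) : E × E →L[ℝ] ℝ)).1
        (connectionMap Γ z (b i)) = 0 := by
  refine (sum_apply_inverse_coord b (isInvertible_of_pos (localMusGradient_pos hpos))
    (localMusGradient_symm hs)
    (L.flip.bilinearComp (connectionMap Γ z) (ContinuousLinearMap.fst ℝ E E))).trans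
    (trace_eq_zero_of_sq_eq_zero _ fun v => ?_)
  have h : ∀ w, (((localMusGradient B Γ η z).inverse ∘L
      L.flip.bilinearComp (connectionMap Γ z) (ContinuousLinearMap.fst ℝ E E)) w) =
      (localMusGradient B Γ η z).inverse
        (L.flip (connectionMap Γ z w) ∘L ContinuousLinearMap.fst ℝ E E) := fun w => rfl
  simp only [ContinuousLinearMap.coe_coe, h, connectionMap_localMusGradient_inverse hpos, map_zero,
    ContinuousLinearMap.zero_comp]

/-- The tension field, as a covector, of the identity map from the Mus-Gradient metric to the Sasaki
metric. -/
theorem localMusGradient_sum_christoffel_sub {ι : Type*} [Fintype ι]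
    (b : Module.Basis ι ℝ (E × E)) (hB : DifferentiableAt ℝ B z.1)
    (hpos : ∀ v, v ≠ 0 → 0 < B z.1 v v) (hs : ∀ v w, B z.1 v w = B z.1 w v)
    (hds : ∀ a v w, fderiv ℝ B z.1 a v w = fderiv ℝ B z.1 a w v)
    (hΓ : DifferentiableAt ℝ Γ z.1) (hΓB : Γ z.1 = localChristoffel B z.1)
    (hη : DifferentiableAt ℝ η z.1) (ζ : E × E) :
    localMusGradient B Γ η z (∑ i,
      (localChristoffel (localSasaki B Γ) z (b i) ((localMusGradient B Γ η z).inverse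
          (LinearMap.toContinuousLinearMap (b.coord i) : E × E →L[ℝ] ℝ))
        - localChristoffel (localMusGradient B Γ η) z (b i) ((localMusGradient B Γ η z).inverse
          (LinearMap.toContinuousLinearMap (b.coord i) : E × E →L[ℝ] ℝ)))) ζ =
      covariantDerivative Γ η z.1 ζ.1 ((B z.1).inverse (η z.1))
        / (1 + η z.1 ((B z.1).inverse (η z.1))) := by
  have hGi : (localMusGradient B Γ η z).IsInvertible :=
    isInvertible_of_pos (localMusGradient_pos hpos)
  have hθ := differentiableAt_comp_connectionMap hη hΓ
  obtain ⟨θ, hθd⟩ : ∃ θ : E × E → E × E →L[ℝ] ℝ, θ = fun x => η x.1 ∘L connectionMap Γ x := ⟨_, rfl⟩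
  have hθz : θ z = η z.1 ∘L connectionMap Γ z := by rw [hθd]
  obtain ⟨l, hl⟩ : ∃ l : E × E →L[ℝ] ℝ, l = (fderiv ℝ θ z).flip ζ - fderiv ℝ θ z ζ := ⟨_, rfl⟩
  have key : ∀ v w, localMusGradient B Γ η z (localChristoffel (localSasaki B Γ) z v w
      - localChristoffel (localMusGradient B Γ η) z v w) ζ =
      (-(1 / 2) * θ z ζ) * (covariantDerivative Γ η z.1 v.1 (connectionMap Γ z w)
        + covariantDerivative Γ η z.1 w.1 (connectionMap Γ z v))
      - (1 / 2) * (l v * θ z w + θ z v * l w) := by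
    intro v w
    have h := metric_christoffel_sub (differentiableAt_localSasaki hB hΓ) hθ
      (isInvertible_of_pos (localSasaki_pos hpos)) hGi v w ζ
    rw [symm_covariantDerivative_comp_connectionMap hB hpos hs hds hΓ hΓB hη, ← hθd, ← hθz] at h
    refine Eq.trans ?_ (h.trans ?_)
    · rw [hθd]
      rfl
    · rw [hl]
      simp only [sub_apply, ContinuousLinearMap.flip_apply]
      ring
  have hsum := sum_rankOne_apply_inverse_coord b hGi (localMusGradient_symm hs)
  rw [map_sum, sum_apply, Finset.sum_congr rfl fun i _ => key _ _, Finset.sum_sub_distrib,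
    ← Finset.mul_sum, ← Finset.mul_sum, Finset.sum_add_distrib, Finset.sum_add_distrib, hsum, hsum,
    sum_covariantDerivative_connectionMap_right b hpos hs,
    sum_covariantDerivative_connectionMap_left b hpos hs,
    inverse_symm hGi (localMusGradient_symm hs) (θ z), hθz,
    localMusGradient_inverse_comp_connectionMap hpos, hl, hθd]
  simp only [sub_apply, ContinuousLinearMap.flip_apply]
  rw [fderiv_comp_connectionMap hη hΓ, fderiv_comp_connectionMap hη hΓ,
    fderiv_connectionMap_apply_vertical hΓ, fderiv_connectionMap_vertical hΓ,
    connectionMap_vertical, covariantDerivative_apply]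
  simp only [map_zero, zero_apply, map_smul, smul_eq_mul]
  ring

/-- The derivative of the squared norm of the covector field `η`. -/
theorem fderiv_apply_inverse {e : E} (hB : DifferentiableAt ℝ B e)
    (hpos : ∀ v, v ≠ 0 → 0 < B e v v) (hs : ∀ v w, B e v w = B e w v)
    (hds : ∀ a v w, fderiv ℝ B e a v w = fderiv ℝ B e a w v)
    (hΓB : Γ e = localChristoffel B e) (hη : DifferentiableAt ℝ η e) {n : E → E}
    (hn : DifferentiableAt ℝ n e) (hBn : ∀ᶠ x in nhds e, B x (n x) = η x) (a : E) :
    fderiv ℝ (fun x => B x (n x) (n x)) e a = 2 * covariantDerivative Γ η e a (n e) := by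
  have hi := isInvertible_of_pos hpos
  have h1 : fderiv ℝ (fun x => B x (n x) (n e)) e a = fderiv ℝ η e a (n e) := by
    rw [fderiv_apply₁ hη, Filter.EventuallyEq.fderiv_eq]
    filter_upwards [hBn] with x hx
    rw [hx]
  rw [fderiv_bilin_apply hB hn (differentiableAt_const _)] at h1
  have hmc := metric_compatible hi hs hds a (n e) (n e)
  rw [fderiv_bilin_apply hB hn hn, covariantDerivative_apply, ← hBn.self_of_nhds, hΓB, ← h1]
  rw [hs (localChristoffel B e a (n e))] at hmc
  have h2 := hs (fderiv ℝ n e a) (n e)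
  simp at *
  linarith

end LocalTension

section ChristoffelTransformation

variable {F : Type*} [NormedAddCommGroup F] [NormedSpace ℝ F]

/-- The transformation law of the Christoffel symbols under a change of coordinates `ψ`. -/
theorem localChristoffel_pullback {A B : F → F →L[ℝ] F →L[ℝ] ℝ} {ψ : F → F} {e : F}
    (hAi : (A e).IsInvertible) (hBi : (B (ψ e)).IsInvertible)
    (hA : DifferentiableAt ℝ A e) (hB : DifferentiableAt ℝ B (ψ e)) (hψ : ContDiffAt ℝ 2 ψ e)
    (hs : ∀ v w, B (ψ e) v w = B (ψ e) w v) (hsurj : Function.Surjective (fderiv ℝ ψ e))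
    (hAB : ∀ᶠ x in nhds e, ∀ v w, A x v w = B (ψ x) (fderiv ℝ ψ x v) (fderiv ℝ ψ x w)) (v w : F) :
    fderiv ℝ ψ e (localChristoffel A e v w) = fderiv ℝ (fderiv ℝ ψ) e v w
      + localChristoffel B (ψ e) (fderiv ℝ ψ e v) (fderiv ℝ ψ e w) := by
  have hψ1 : DifferentiableAt ℝ ψ e := hψ.differentiableAt (by norm_num)
  have hψ2 : DifferentiableAt ℝ (fderiv ℝ ψ) e :=
    (hψ.fderiv_right (m := 1) (by norm_num)).differentiableAt (by norm_num)
  have hBψ : DifferentiableAt ℝ (fun x => B (ψ x)) e := hB.comp e hψ1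
  have hBψd : ∀ a, fderiv ℝ (fun x => B (ψ x)) e a = fderiv ℝ B (ψ e) (fderiv ℝ ψ e a) := fun a => by
    have h : HasFDerivAt (fun x => B (ψ x)) _ e := hB.hasFDerivAt.comp e hψ1.hasFDerivAt
    rw [h.fderiv]
    rfl
  have hsymm : ∀ a b, fderiv ℝ (fderiv ℝ ψ) e a b = fderiv ℝ (fderiv ℝ ψ) e b a := fun a b =>
    hψ.isSymmSndFDerivAt (by simp) a b
  have hd : ∀ a b c, fderiv ℝ A e a b c =
      fderiv ℝ B (ψ e) (fderiv ℝ ψ e a) (fderiv ℝ ψ e b) (fderiv ℝ ψ e c)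
      + B (ψ e) (fderiv ℝ (fderiv ℝ ψ) e a b) (fderiv ℝ ψ e c)
      + B (ψ e) (fderiv ℝ ψ e b) (fderiv ℝ (fderiv ℝ ψ) e a c) := by
    intro a b c
    have heq : (fun x => A x b c) =ᶠ[nhds e] fun x => B (ψ x) (fderiv ℝ ψ x b) (fderiv ℝ ψ x c) := by
      filter_upwards [hAB] with x hx using hx b c
    rw [fderiv_apply₂ hA, heq.fderiv_eq, fderiv_bilin_apply hBψ
      (hψ2.clm_apply (differentiableAt_const b)) (hψ2.clm_apply (differentiableAt_const c)),
      ← fderiv_apply₁ hψ2, ← fderiv_apply₁ hψ2, hBψd]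
  have hinj : ∀ x y, (∀ u, B (ψ e) x u = B (ψ e) y u) → x = y := fun x y hxy => by
    rw [← inverse_apply_apply hBi x, ← inverse_apply_apply hBi y, ContinuousLinearMap.ext hxy]
  refine hinj _ _ fun u => ?_
  obtain ⟨c, rfl⟩ := hsurj u
  rw [← hAB.self_of_nhds, metric_localChristoffel hAi, map_add, add_apply,
    metric_localChristoffel hBi, hd, hd, hd, hsymm w v, hsymm c v, hsymm c w,
    hs _ (fderiv ℝ (fderiv ℝ ψ) e v c)]
  ring

end ChristoffelTransformation

section Transition

variable {E : Type*} [NormedAddCommGroup E] [NormedSpace ℝ E]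
  {H : Type*} [TopologicalSpace H] {I : ModelWithCorners ℝ E H}
  {M : Type*} [TopologicalSpace M] [ChartedSpace H M]

/-- The change of coordinates from the preferred chart at `p` to the one at `q`. -/
def transition (I : ModelWithCorners ℝ E H) (p q : M) : E → E :=
  extChartAt I q ∘ (extChartAt I p).symm

/-- A metric, as a family of bilinear forms on the model space. -/
def form (G : MetricField I M) (m : M) : E →L[ℝ] E →L[ℝ] ℝ := G m

/-- The derivative of the inverse of the preferred chart at `p`, as an endomorphism of the model
space. -/
def chartDeriv (I : ModelWithCorners ℝ E H) (p : M) (e : E) : E →L[ℝ] E :=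
  mfderiv 𝓘(ℝ, E) I (extChartAt I p).symm e

theorem chartMetric_apply (G : MetricField I M) (p : M) (e v w : E) :
    chartMetric G p e v w = form G ((extChartAt I p).symm e)
      (chartDeriv I p e v) (chartDeriv I p e w) := rfl

theorem transition_mem_target {p q : M} {e : E}
    (hq : (extChartAt I p).symm e ∈ (extChartAt I q).source) :
    transition I p q e ∈ (extChartAt I q).target := (extChartAt I q).map_source hq

theorem extChartAt_symm_transition {p q : M} {e : E}
    (hq : (extChartAt I p).symm e ∈ (extChartAt I q).source) :
    (extChartAt I q).symm (transition I p q e) = (extChartAt I p).symm e :=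
  (extChartAt I q).left_inv hq

theorem transition_transition {p q : M} {e : E} (he : e ∈ (extChartAt I p).target)
    (hq : (extChartAt I p).symm e ∈ (extChartAt I q).source) :
    transition I q p (transition I p q e) = e := by
  rw [transition, Function.comp_apply, extChartAt_symm_transition hq, (extChartAt I p).right_inv he]

theorem chartMetric_symm {G : MetricField I M}
    (hG : ∀ p v w, form G p v w = form G p w v) (p : M)
    (e v w : E) : chartMetric G p e v w = chartMetric G p e w v := by
  rw [chartMetric_apply, chartMetric_apply, hG]

variable [I.Boundaryless]

theorem fderiv_transition_self {p : M} {e : E} (he : e ∈ (extChartAt I p).target) :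
    fderiv ℝ (transition I p p) e = ContinuousLinearMap.id ℝ E := by
  have heq : transition I p p =ᶠ[nhds e] id := by
    filter_upwards [(isOpen_extChartAt_target p).mem_nhds he] with x hx
      using (extChartAt I p).right_inv hx
  rw [heq.fderiv_eq, fderiv_id]

theorem eventually_mem_target_and_mem_source {p q : M} {e : E} (he : e ∈ (extChartAt I p).target)
    (hq : (extChartAt I p).symm e ∈ (extChartAt I q).source) :
    ∀ᶠ x in nhds e, x ∈ (extChartAt I p).target ∧
      (extChartAt I p).symm x ∈ (extChartAt I q).source :=
  (Filter.eventually_mem_set.2 ((isOpen_extChartAt_target p).mem_nhds he)).and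
    ((continuousAt_extChartAt_symm'' he).eventually ((isOpen_extChartAt_source q).mem_nhds hq))

variable [IsManifold I ∞ M]

theorem mdifferentiableAt_extChartAt_symm {p : M} {e : E} (he : e ∈ (extChartAt I p).target) :
    MDifferentiableAt 𝓘(ℝ, E) I (extChartAt I p).symm e := by
  have : IsManifold I 1 M := .of_le (n := ∞) (by simp)
  have h := mdifferentiableWithinAt_extChartAt_symm (I := I) he
  rwa [I.range_eq_univ, mdifferentiableWithinAt_univ] at h

/-- In the preferred coordinates of the tangent spaces, the derivative of the inverse of a chart
is the derivative of a transition map. -/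
theorem chartDeriv_eq_fderiv_transition {p : M} {e : E} (he : e ∈ (extChartAt I p).target) :
    chartDeriv I p e =
      fderiv ℝ (transition I p ((extChartAt I p).symm e)) e := by
  refine (mdifferentiableAt_extChartAt_symm he).mfderiv.trans ?_
  simp only [writtenInExtChartAt, extChartAt_model_space_eq_id, PartialEquiv.refl_symm,
    PartialEquiv.refl_coe, Function.comp_id, modelWithCornersSelf_coe, Set.range_id,
    fderivWithin_univ, id_eq, transition]
  rfl

theorem contDiffAt_transition {p q : M} {e : E} (he : e ∈ (extChartAt I p).target)
    (hq : (extChartAt I p).symm e ∈ (extChartAt I q).source) :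
    ContDiffAt ℝ ∞ (transition I p q) e := by
  have h := contDiffWithinAt_ext_coord_change (n := ∞) (I := I) q p (y := e)
    (by simp only [PartialEquiv.trans_source, PartialEquiv.symm_source]; exact ⟨he, hq⟩)
  rwa [I.range_eq_univ, contDiffWithinAt_univ] at h

theorem differentiableAt_transition {p q : M} {e : E} (he : e ∈ (extChartAt I p).target)
    (hq : (extChartAt I p).symm e ∈ (extChartAt I q).source) :
    DifferentiableAt ℝ (transition I p q) e :=
  (contDiffAt_transition he hq).differentiableAt (by simp)

theorem fderiv_transition_comp {p q r : M} {e : E} (he : e ∈ (extChartAt I p).target)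
    (hq : (extChartAt I p).symm e ∈ (extChartAt I q).source)
    (hr : (extChartAt I p).symm e ∈ (extChartAt I r).source) :
    fderiv ℝ (transition I p r) e =
      fderiv ℝ (transition I q r) (transition I p q e) ∘L fderiv ℝ (transition I p q) e := by
  have heq : transition I p r =ᶠ[nhds e] transition I q r ∘ transition I p q := by
    filter_upwards [eventually_mem_target_and_mem_source he hq] with x hx
    simp only [Function.comp_apply]
    rw [transition, transition, Function.comp_apply, Function.comp_apply,
      extChartAt_symm_transition hx.2]
  rw [heq.fderiv_eq, fderiv_comp e _ (differentiableAt_transition he hq)]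
  refine differentiableAt_transition (transition_mem_target hq) ?_
  rwa [extChartAt_symm_transition hq]

theorem fderiv_transition_inverse {p q : M} {e : E} (he : e ∈ (extChartAt I p).target)
    (hq : (extChartAt I p).symm e ∈ (extChartAt I q).source) (v : E) :
    fderiv ℝ (transition I q p) (transition I p q e) (fderiv ℝ (transition I p q) e v) = v := by
  have h := fderiv_transition_comp he hq ((extChartAt I p).map_target he)
  rw [fderiv_transition_self he] at h
  exact (DFunLike.congr_fun h v).symm

theorem surjective_fderiv_transition {p q : M} {e : E} (he : e ∈ (extChartAt I p).target)
    (hq : (extChartAt I p).symm e ∈ (extChartAt I q).source) :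
    Function.Surjective (fderiv ℝ (transition I p q) e) := fun v => by
  have h := fderiv_transition_inverse (q := p) (transition_mem_target hq)
    (by rw [extChartAt_symm_transition hq]; exact (extChartAt I p).map_target he) v
  rw [transition_transition he hq] at h
  exact ⟨_, h⟩

theorem chartMetric_apply_transition (G : MetricField I M) {p : M} {e : E}
    (he : e ∈ (extChartAt I p).target) (v w : E) :
    chartMetric G p e v w = form G ((extChartAt I p).symm e)
      (fderiv ℝ (transition I p ((extChartAt I p).symm e)) e v)
      (fderiv ℝ (transition I p ((extChartAt I p).symm e)) e w) := by
  rw [chartMetric_apply, chartDeriv_eq_fderiv_transition he]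

theorem chartMetric_self (G : MetricField I M) (p : M) :
    chartMetric G p (extChartAt I p p) = form G p := by
  refine ContinuousLinearMap.ext fun v => ContinuousLinearMap.ext fun w => ?_
  rw [chartMetric_apply_transition G (mem_extChartAt_target p), extChartAt_to_inv,
    fderiv_transition_self (mem_extChartAt_target p)]
  rfl

theorem chartMetric_transition (G : MetricField I M) {p q : M} {e : E}
    (he : e ∈ (extChartAt I p).target)
    (hq : (extChartAt I p).symm e ∈ (extChartAt I q).source) (v w : E) :
    chartMetric G p e v w = chartMetric G q (transition I p q e)
      (fderiv ℝ (transition I p q) e v) (fderiv ℝ (transition I p q) e w) := by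
  rw [chartMetric_apply_transition G he, chartMetric_apply_transition G (transition_mem_target hq),
    extChartAt_symm_transition hq,
    fderiv_transition_comp he hq (mem_extChartAt_source _)]
  rfl

theorem chartMetric_pos {G : MetricField I M}
    (hG : ∀ p v, v ≠ 0 → 0 < form G p v v) {p : M} {e : E}
    (he : e ∈ (extChartAt I p).target) (v : E) (hv : v ≠ 0) : 0 < chartMetric G p e v v := by
  rw [chartMetric_apply_transition G he]
  refine hG _ _ fun h => hv ?_
  rw [← fderiv_transition_inverse he (mem_extChartAt_source _) v, h, map_zero]

theorem christoffel_transition [FiniteDimensional ℝ E] {G : MetricField I M}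
    (hs : ∀ p v w, form G p v w = form G p w v)
    (hpos : ∀ p v, v ≠ 0 → 0 < form G p v v)
    (hdiff : ∀ p, ∀ e ∈ (extChartAt I p).target, DifferentiableAt ℝ (chartMetric G p) e)
    {p q : M} {e : E} (he : e ∈ (extChartAt I p).target)
    (hq : (extChartAt I p).symm e ∈ (extChartAt I q).source) (v w : E) :
    fderiv ℝ (transition I p q) e (christoffel G p e v w) =
      fderiv ℝ (fderiv ℝ (transition I p q)) e v w + christoffel G q (transition I p q e)
        (fderiv ℝ (transition I p q) e v) (fderiv ℝ (transition I p q) e w) := by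
  have ht := transition_mem_target hq
  refine localChristoffel_pullback (isInvertible_of_pos (chartMetric_pos hpos he))
    (isInvertible_of_pos (chartMetric_pos hpos ht)) (hdiff p e he) (hdiff q _ ht)
    (contDiffAt_infty.1 (contDiffAt_transition he hq) 2) (chartMetric_symm hs _ _)
    (surjective_fderiv_transition he hq) ?_ v w
  filter_upwards [eventually_mem_target_and_mem_source he hq] with x hx v w
    using chartMetric_transition G hx.1 hx.2 v w

end Transition

section TangentBundleCharts

variable {E : Type*} [NormedAddCommGroup E] [NormedSpace ℝ E]
  {M : Type*} [TopologicalSpace M] [ChartedSpace E M] [IsManifold 𝓘(ℝ, E) ∞ M]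

theorem mem_tangent_extChartAt_target {P : TangentBundle 𝓘(ℝ, E) M} {z : E × E} :
    z ∈ (extChartAt 𝓘(ℝ, E).tangent P).target ↔ z.1 ∈ (extChartAt 𝓘(ℝ, E) P.proj).target := by
  simp only [extChartAt, OpenPartialHomeomorph.extend, PartialEquiv.trans_target,
    Set.univ_inter, mfld_simps]
  exact TangentBundle.mem_chart_target_iff z P

theorem tangent_coordChange_eq {p q : M} {e : E} (he : e ∈ (extChartAt 𝓘(ℝ, E) p).target) :
    (tangentBundleCore 𝓘(ℝ, E) M).coordChange (achart E p) (achart E q)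
      ((extChartAt 𝓘(ℝ, E) p).symm e) = fderiv ℝ (transition 𝓘(ℝ, E) p q) e := by
  rw [tangentBundleCore_coordChange_achart, (extChartAt 𝓘(ℝ, E) p).right_inv he,
    modelWithCornersSelf_coe, Set.range_id, fderivWithin_univ]
  rfl

theorem transition_tangent {P Q : TangentBundle 𝓘(ℝ, E) M} {z : E × E}
    (hz : z.1 ∈ (extChartAt 𝓘(ℝ, E) P.proj).target)
    (hq : (extChartAt 𝓘(ℝ, E) P.proj).symm z.1 ∈ (extChartAt 𝓘(ℝ, E) Q.proj).source) :
    transition 𝓘(ℝ, E).tangent P Q z = (transition 𝓘(ℝ, E) P.proj Q.proj z.1,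
      fderiv ℝ (transition 𝓘(ℝ, E) P.proj Q.proj) z.1 z.2) := by
  rw [← tangent_coordChange_eq hz]
  refine Prod.ext rfl ?_
  have hp := (extChartAt 𝓘(ℝ, E) P.proj).map_target hz
  rw [extChartAt_source] at hp hq
  exact (tangentBundleCore 𝓘(ℝ, E) M).coordChange_comp (achart E P.proj)
    (achart E ((extChartAt 𝓘(ℝ, E) P.proj).symm z.1)) (achart E Q.proj)
    ((extChartAt 𝓘(ℝ, E) P.proj).symm z.1) ⟨⟨hp, mem_chart_source E _⟩, hq⟩ z.2

theorem fderiv_transition_tangent {P Q : TangentBundle 𝓘(ℝ, E) M} {z : E × E}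
    (hz : z.1 ∈ (extChartAt 𝓘(ℝ, E) P.proj).target)
    (hq : (extChartAt 𝓘(ℝ, E) P.proj).symm z.1 ∈ (extChartAt 𝓘(ℝ, E) Q.proj).source) (v : E × E) :
    fderiv ℝ (transition 𝓘(ℝ, E).tangent P Q) z v =
      (fderiv ℝ (transition 𝓘(ℝ, E) P.proj Q.proj) z.1 v.1,
        fderiv ℝ (fderiv ℝ (transition 𝓘(ℝ, E) P.proj Q.proj)) z.1 v.1 z.2
          + fderiv ℝ (transition 𝓘(ℝ, E) P.proj Q.proj) z.1 v.2) := by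
  have heq : transition 𝓘(ℝ, E).tangent P Q =ᶠ[nhds z] fun x =>
      (transition 𝓘(ℝ, E) P.proj Q.proj x.1,
        fderiv ℝ (transition 𝓘(ℝ, E) P.proj Q.proj) x.1 x.2) := by
    have h := continuousAt_fst.eventually (eventually_mem_target_and_mem_source hz hq)
    filter_upwards [h] with x hx using transition_tangent hx.1 hx.2
  have hψ := contDiffAt_transition hz hq
  have hψ1 := hψ.differentiableAt (by simp)
  have hψ2 : DifferentiableAt ℝ (fderiv ℝ (transition 𝓘(ℝ, E) P.proj Q.proj)) z.1 :=
    ((contDiffAt_infty.1 hψ 2).fderiv_right (m := 1) (by norm_num)).differentiableAt (by norm_num)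
  have h : HasFDerivAt (fun x : E × E => (transition 𝓘(ℝ, E) P.proj Q.proj x.1,
      fderiv ℝ (transition 𝓘(ℝ, E) P.proj Q.proj) x.1 x.2)) _ z :=
    (hψ1.hasFDerivAt.comp z hasFDerivAt_fst).prodMk
      ((hψ2.hasFDerivAt.comp z hasFDerivAt_fst).clm_apply hasFDerivAt_snd)
  rw [heq.fderiv_eq, h.fderiv]
  refine Prod.ext rfl ?_
  exact add_comm _ _

theorem chartDeriv_tangent {P : TangentBundle 𝓘(ℝ, E) M} {z : E × E}
    (hz : z.1 ∈ (extChartAt 𝓘(ℝ, E) P.proj).target) (v : E × E) :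
    chartDeriv 𝓘(ℝ, E).tangent P z v = (chartDeriv 𝓘(ℝ, E) P.proj z.1 v.1,
      fderiv ℝ (fderiv ℝ (transition 𝓘(ℝ, E) P.proj ((extChartAt 𝓘(ℝ, E) P.proj).symm z.1)))
        z.1 v.1 z.2 + chartDeriv 𝓘(ℝ, E) P.proj z.1 v.2) := by
  rw [chartDeriv_eq_fderiv_transition hz]
  have h := chartDeriv_eq_fderiv_transition (mem_tangent_extChartAt_target.2 hz)
  refine (DFunLike.congr_fun h v).trans ?_
  exact fderiv_transition_tangent hz (mem_extChartAt_source _) v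

theorem verticalPart_extChartAt_symm (g : MetricField 𝓘(ℝ, E) M) {P : TangentBundle 𝓘(ℝ, E) M}
    {z : E × E} (hz : z.1 ∈ (extChartAt 𝓘(ℝ, E) P.proj).target) (x : E × E) :
    verticalPart g ((extChartAt 𝓘(ℝ, E).tangent P).symm z) x =
      x.2 + christoffel g ((extChartAt 𝓘(ℝ, E) P.proj).symm z.1)
        (transition 𝓘(ℝ, E) P.proj ((extChartAt 𝓘(ℝ, E) P.proj).symm z.1) z.1) x.1
        (chartDeriv 𝓘(ℝ, E) P.proj z.1 z.2) := by
  rw [chartDeriv_eq_fderiv_transition hz, ← tangent_coordChange_eq hz]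
  rfl

theorem verticalPart_chartDeriv [FiniteDimensional ℝ E] {g : MetricField 𝓘(ℝ, E) M}
    (hs : ∀ p v w, form g p v w = form g p w v) (hpos : ∀ p v, v ≠ 0 → 0 < form g p v v)
    (hdiff : ∀ p, ∀ e ∈ (extChartAt 𝓘(ℝ, E) p).target, DifferentiableAt ℝ (chartMetric g p) e)
    {P : TangentBundle 𝓘(ℝ, E) M} {z : E × E}
    (hz : z.1 ∈ (extChartAt 𝓘(ℝ, E) P.proj).target) (v : E × E) :
    verticalPart g ((extChartAt 𝓘(ℝ, E).tangent P).symm z)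
        (chartDeriv 𝓘(ℝ, E).tangent P z v) =
      chartDeriv 𝓘(ℝ, E) P.proj z.1 (connectionMap (christoffel g P.proj) z v) := by
  refine (verticalPart_extChartAt_symm g hz _).trans ?_
  rw [chartDeriv_tangent hz, connectionMap_apply, map_add, chartDeriv_eq_fderiv_transition hz,
    christoffel_transition hs hpos hdiff hz (mem_extChartAt_source _)]
  simp only
  abel

theorem horizontalPart_chartDeriv {P : TangentBundle 𝓘(ℝ, E) M} {z : E × E}
    (hz : z.1 ∈ (extChartAt 𝓘(ℝ, E) P.proj).target) (v : E × E) :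
    horizontalPart ((extChartAt 𝓘(ℝ, E).tangent P).symm z)
        (chartDeriv 𝓘(ℝ, E).tangent P z v) = chartDeriv 𝓘(ℝ, E) P.proj z.1 v.1 :=
  congrArg Prod.fst (chartDeriv_tangent hz v)

theorem form_sasaki (g : MetricField 𝓘(ℝ, E) M) (P : TangentBundle 𝓘(ℝ, E) M) (v w : E × E) :
    form (sasaki g) P v w = form g P.proj (horizontalPart P v) (horizontalPart P w)
      + form g P.proj (verticalPart g P v) (verticalPart g P w) := rfl

theorem chartMetric_sasaki [FiniteDimensional ℝ E] {g : MetricField 𝓘(ℝ, E) M}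
    (hs : ∀ p v w, form g p v w = form g p w v) (hpos : ∀ p v, v ≠ 0 → 0 < form g p v v)
    (hdiff : ∀ p, ∀ e ∈ (extChartAt 𝓘(ℝ, E) p).target, DifferentiableAt ℝ (chartMetric g p) e)
    {P : TangentBundle 𝓘(ℝ, E) M} {z : E × E}
    (hz : z.1 ∈ (extChartAt 𝓘(ℝ, E) P.proj).target) :
    chartMetric (sasaki g) P z = localSasaki (chartMetric g P.proj) (christoffel g P.proj) z := by
  refine ContinuousLinearMap.ext fun v => ContinuousLinearMap.ext fun w => ?_
  rw [chartMetric_apply, form_sasaki, verticalPart_chartDeriv hs hpos hdiff hz,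
    verticalPart_chartDeriv hs hpos hdiff hz, horizontalPart_chartDeriv hz,
    horizontalPart_chartDeriv hz]
  rfl

/-- The differential of a function, as a family of linear forms on the model space. -/
def differential (f : M → ℝ) (m : M) : E →L[ℝ] ℝ := mfderiv 𝓘(ℝ, E) 𝓘(ℝ, ℝ) f m

/-- The differential of a function in the preferred chart at `p`. -/
def chartDifferential (f : M → ℝ) (p : M) (e : E) : E →L[ℝ] ℝ :=
  fderiv ℝ (f ∘ (extChartAt 𝓘(ℝ, E) p).symm) e

theorem chartDifferential_apply {f : M → ℝ} {p : M} {e : E}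
    (he : e ∈ (extChartAt 𝓘(ℝ, E) p).target)
    (hf : MDifferentiableAt 𝓘(ℝ, E) 𝓘(ℝ, ℝ) f ((extChartAt 𝓘(ℝ, E) p).symm e)) (v : E) :
    chartDifferential f p e v =
      differential f ((extChartAt 𝓘(ℝ, E) p).symm e)
        (chartDeriv 𝓘(ℝ, E) p e v) := by
  rw [chartDifferential, ← mfderiv_eq_fderiv,
    mfderiv_comp e hf (mdifferentiableAt_extChartAt_symm he)]
  rfl

theorem form_musGradient (g : MetricField 𝓘(ℝ, E) M) (f : M → ℝ) (P : TangentBundle 𝓘(ℝ, E) M)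
    (v w : E × E) :
    form (musGradient g f) P v w = form (sasaki g) P v w
      + differential f P.proj (verticalPart g P v) * differential f P.proj (verticalPart g P w) :=
  rfl

theorem chartMetric_musGradient [FiniteDimensional ℝ E] {g : MetricField 𝓘(ℝ, E) M}
    (hs : ∀ p v w, form g p v w = form g p w v) (hpos : ∀ p v, v ≠ 0 → 0 < form g p v v)
    (hdiff : ∀ p, ∀ e ∈ (extChartAt 𝓘(ℝ, E) p).target, DifferentiableAt ℝ (chartMetric g p) e)
    {f : M → ℝ} (hf : MDifferentiable 𝓘(ℝ, E) 𝓘(ℝ, ℝ) f)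
    {P : TangentBundle 𝓘(ℝ, E) M} {z : E × E}
    (hz : z.1 ∈ (extChartAt 𝓘(ℝ, E) P.proj).target) :
    chartMetric (musGradient g f) P z =
      localMusGradient (chartMetric g P.proj) (christoffel g P.proj)
        (chartDifferential f P.proj) z := by
  refine ContinuousLinearMap.ext fun v => ContinuousLinearMap.ext fun w => ?_
  rw [chartMetric_apply, form_musGradient, ← chartMetric_apply, chartMetric_sasaki hs hpos hdiff hz,
    verticalPart_chartDeriv hs hpos hdiff hz,
    verticalPart_chartDeriv hs hpos hdiff hz, localMusGradient, add_apply, add_apply]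
  congr 1
  refine Eq.trans ?_ (congrArg₂ (· * ·)
    (chartDifferential_apply hz (hf _) (connectionMap (christoffel g P.proj) z v)).symm
    (chartDifferential_apply hz (hf _) (connectionMap (christoffel g P.proj) z w)).symm)
  rfl

end TangentBundleCharts

section Smoothness

theorem differentiableAt_inverse {D F : Type*} [NormedAddCommGroup D] [NormedSpace ℝ D]
    [NormedAddCommGroup F] [NormedSpace ℝ F] [CompleteSpace F] {K : D → F →L[ℝ] F →L[ℝ] ℝ} {e : D}
    (hK : DifferentiableAt ℝ K e) (hi : (K e).IsInvertible) :
    DifferentiableAt ℝ (fun x => (K x).inverse) e :=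
  ((hi.contDiffAt_map_inverse (n := 1)).differentiableAt (by norm_num)).comp e hK

theorem differentiableAt_localChristoffel {F : Type*}
    [NormedAddCommGroup F] [NormedSpace ℝ F] [CompleteSpace F] {K : F → F →L[ℝ] F →L[ℝ] ℝ} {e : F}
    (hK : ContDiffAt ℝ 2 K e) (hi : (K e).IsInvertible) :
    DifferentiableAt ℝ (localChristoffel K) e := by
  have hd : DifferentiableAt ℝ (fderiv ℝ K) e :=
    (hK.fderiv_right (m := 1) (by norm_num)).differentiableAt (by norm_num)
  have hfirst : DifferentiableAt ℝ (localChristoffelFirst K) e :=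
    ((hd.add hd.clm_flip).sub ((differentiableAt_const
      ((ContinuousLinearMap.flipₗᵢ ℝ F F ℝ : (F →L[ℝ] F →L[ℝ] ℝ) →L[ℝ] (F →L[ℝ] F →L[ℝ] ℝ)))).clm_comp
        hd.clm_flip)).const_smul (1 / 2 : ℝ)
  exact ((ContinuousLinearMap.compL ℝ F (F →L[ℝ] ℝ) F).differentiableAt.comp e
    (differentiableAt_inverse (hK.differentiableAt (by norm_num)) hi)).clm_comp hfirst

variable {E : Type*} [NormedAddCommGroup E] [NormedSpace ℝ E]
  {M : Type*} [TopologicalSpace M] [ChartedSpace E M] [IsManifold 𝓘(ℝ, E) ∞ M]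

theorem contMDiffAt_chartDeriv_apply {p : M} {e : E} (he : e ∈ (extChartAt 𝓘(ℝ, E) p).target)
    (v : E) : ContMDiffAt 𝓘(ℝ, E) 𝓘(ℝ, E).tangent ∞
      (fun x => (⟨(extChartAt 𝓘(ℝ, E) p).symm x, chartDeriv 𝓘(ℝ, E) p x v⟩ :
        TangentBundle 𝓘(ℝ, E) M)) e := by
  let P : TangentBundle 𝓘(ℝ, E) M := ⟨p, (0 : E)⟩
  have ht : ((e, v) : E × E) ∈ (extChartAt 𝓘(ℝ, E).tangent P).target :=
    mem_tangent_extChartAt_target.2 he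
  have h1 : ContMDiffAt 𝓘(ℝ, E × E) 𝓘(ℝ, E).tangent ∞ (extChartAt 𝓘(ℝ, E).tangent P).symm
      ((e, v) : E × E) :=
    (contMDiffOn_extChartAt_symm (n := ∞) P).contMDiffAt ((isOpen_extChartAt_target P).mem_nhds ht)
  have h2 : ContMDiffAt 𝓘(ℝ, E) 𝓘(ℝ, E × E) ∞ (fun x : E => ((x, v) : E × E)) e :=
    (contDiff_id.prodMk contDiff_const).contMDiff.contMDiffAt
  refine (ContMDiffAt.comp e h1 h2).congr_of_eventuallyEq ?_
  filter_upwards [(isOpen_extChartAt_target p).mem_nhds he] with x hx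
  rw [chartDeriv_eq_fderiv_transition hx, ← tangent_coordChange_eq hx]
  rfl

theorem contDiffOn_chartMetric [FiniteDimensional ℝ E]
    (g : ContMDiffRiemannianMetric 𝓘(ℝ, E) ∞ E (fun x : M => TangentSpace 𝓘(ℝ, E) x)) (p : M) :
    ContDiffOn ℝ ∞ (chartMetric (I := 𝓘(ℝ, E)) g.inner p) (extChartAt 𝓘(ℝ, E) p).target := by
  refine contDiffOn_clm_apply.2 fun v => contDiffOn_clm_apply.2 fun w => fun e he => ?_
  refine ContDiffAt.contDiffWithinAt ?_
  rw [← contMDiffAt_iff_contDiffAt]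
  have hb : ContMDiffAt 𝓘(ℝ, E) 𝓘(ℝ, E) ∞ (extChartAt 𝓘(ℝ, E) p).symm e :=
    (contMDiffOn_extChartAt_symm (n := ∞) p).contMDiffAt ((isOpen_extChartAt_target p).mem_nhds he)
  have h : ContMDiffAt 𝓘(ℝ, E) (𝓘(ℝ, E).prod 𝓘(ℝ, ℝ)) ∞
      (fun x => TotalSpace.mk' ℝ (E := Bundle.Trivial M ℝ) ((extChartAt 𝓘(ℝ, E) p).symm x)
        (g.inner ((extChartAt 𝓘(ℝ, E) p).symm x) (chartDeriv 𝓘(ℝ, E) p x v)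
          (chartDeriv 𝓘(ℝ, E) p x w))) e := by
    apply ContMDiffAt.clm_bundle_apply₂ (F₁ := E) (F₂ := E)
    · exact ContMDiffAt.comp e g.contMDiff.contMDiffAt hb
    · exact contMDiffAt_chartDeriv_apply he v
    · exact contMDiffAt_chartDeriv_apply he w
  simp only [contMDiffAt_totalSpace] at h
  exact h.2

end Smoothness

section Gradient

variable {E : Type*} [NormedAddCommGroup E] [NormedSpace ℝ E]
  {M : Type*} [TopologicalSpace M] [ChartedSpace E M] {g : MetricField 𝓘(ℝ, E) M}

/-- The square of the norm of the gradient. -/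
def gradNormSq (g : MetricField 𝓘(ℝ, E) M) (f : M → ℝ) (m : M) : ℝ :=
  form g m ((form g m).inverse (differential f m)) ((form g m).inverse (differential f m))

theorem gradNorm_eq_sqrt (g : MetricField 𝓘(ℝ, E) M) (f : M → ℝ) (m : M) :
    gradNorm g f m = √(gradNormSq g f m) := rfl

theorem gradNormSq_eq [FiniteDimensional ℝ E] (hpos : ∀ p v, v ≠ 0 → 0 < form g p v v) (f : M → ℝ) (m : M) :
    gradNormSq g f m = differential f m ((form g m).inverse (differential f m)) := by
  rw [gradNormSq, apply_inverse_apply (isInvertible_of_pos (hpos m))]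

theorem gradNormSq_nonneg (hpos : ∀ p v, v ≠ 0 → 0 < form g p v v) (f : M → ℝ) (m : M) :
    0 ≤ gradNormSq g f m := by
  rw [gradNormSq]
  rcases eq_or_ne ((form g m).inverse (differential f m)) 0 with h | h
  · simp [h]
  · exact (hpos m _ h).le

theorem fderiv_chartMetric_symm (hs : ∀ p v w, form g p v w = form g p w v) {p : M} {e : E}
    (hg : DifferentiableAt ℝ (chartMetric g p) e) (a v w : E) :
    fderiv ℝ (chartMetric g p) e a v w = fderiv ℝ (chartMetric g p) e a w v := by
  rw [fderiv_apply₂ hg, fderiv_apply₂ hg]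
  simp only [chartMetric_symm hs p _ v w]

variable [IsManifold 𝓘(ℝ, E) ∞ M]

theorem surjective_chartDeriv {p : M} {e : E} (he : e ∈ (extChartAt 𝓘(ℝ, E) p).target) :
    Function.Surjective (chartDeriv 𝓘(ℝ, E) p e) := by
  rw [chartDeriv_eq_fderiv_transition he]
  exact surjective_fderiv_transition he (mem_extChartAt_source _)

theorem differential_of_eventuallyEq_comp_extChartAt {h : M → ℝ} {F : E → ℝ} {p : M}
    (hF : DifferentiableAt ℝ F (extChartAt 𝓘(ℝ, E) p p))
    (heq : h =ᶠ[nhds p] F ∘ extChartAt 𝓘(ℝ, E) p) :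
    MDifferentiableAt 𝓘(ℝ, E) 𝓘(ℝ, ℝ) h p ∧
      differential h p = fderiv ℝ F (extChartAt 𝓘(ℝ, E) p p) := by
  have : IsManifold 𝓘(ℝ, E) 1 M := .of_le (n := ∞) (by simp)
  have hφ : MDifferentiableAt 𝓘(ℝ, E) 𝓘(ℝ, E) (extChartAt 𝓘(ℝ, E) p) p :=
    mdifferentiableAt_extChartAt (mem_chart_source E p)
  have hF' := hF.mdifferentiableAt
  refine ⟨(hF'.comp p hφ).congr_of_eventuallyEq heq, ?_⟩
  rw [differential, heq.mfderiv_eq, mfderiv_comp p hF' hφ, mfderiv_extChartAt_self, mfderiv_eq_fderiv]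
  rfl

theorem chartDifferential_self {f : M → ℝ} {p : M} (hf : MDifferentiableAt 𝓘(ℝ, E) 𝓘(ℝ, ℝ) f p) :
    chartDifferential f p (extChartAt 𝓘(ℝ, E) p p) = differential f p := by
  have hp := mem_extChartAt_target (I := 𝓘(ℝ, E)) p
  refine ContinuousLinearMap.ext fun v => ?_
  rw [chartDifferential_apply hp (by rwa [extChartAt_to_inv]), chartDeriv_eq_fderiv_transition hp,
    extChartAt_to_inv, fderiv_transition_self hp]
  rfl

theorem contDiffAt_comp_extChartAt_symm {f : M → ℝ} (hf : ContMDiff 𝓘(ℝ, E) 𝓘(ℝ, ℝ) ∞ f) {p : M}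
    {e : E} (he : e ∈ (extChartAt 𝓘(ℝ, E) p).target) :
    ContDiffAt ℝ ∞ (f ∘ (extChartAt 𝓘(ℝ, E) p).symm) e := by
  rw [← contMDiffAt_iff_contDiffAt]
  exact ContMDiffAt.comp e hf.contMDiffAt
    ((contMDiffOn_extChartAt_symm (n := ∞) p).contMDiffAt ((isOpen_extChartAt_target p).mem_nhds he))

theorem differentiableAt_chartDifferential {f : M → ℝ} (hf : ContMDiff 𝓘(ℝ, E) 𝓘(ℝ, ℝ) ∞ f) {p : M}
    {e : E} (he : e ∈ (extChartAt 𝓘(ℝ, E) p).target) :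
    DifferentiableAt ℝ (chartDifferential f p) e :=
  ((contDiffAt_infty.1 (contDiffAt_comp_extChartAt_symm hf he) 2).fderiv_right (m := 1)
    (by norm_num)).differentiableAt (by norm_num)

variable [FiniteDimensional ℝ E]

/-- The gradient in the preferred chart at `p`. -/
theorem chartDeriv_inverse_chartDifferential (hpos : ∀ p v, v ≠ 0 → 0 < form g p v v) {f : M → ℝ}
    (hf : MDifferentiable 𝓘(ℝ, E) 𝓘(ℝ, ℝ) f) {p : M} {e : E}
    (he : e ∈ (extChartAt 𝓘(ℝ, E) p).target) :
    chartDeriv 𝓘(ℝ, E) p e ((chartMetric g p e).inverse (chartDifferential f p e)) =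
      (form g ((extChartAt 𝓘(ℝ, E) p).symm e)).inverse
        (differential f ((extChartAt 𝓘(ℝ, E) p).symm e)) := by
  rw [← inverse_apply_apply (isInvertible_of_pos (hpos ((extChartAt 𝓘(ℝ, E) p).symm e)))
    (chartDeriv 𝓘(ℝ, E) p e ((chartMetric g p e).inverse (chartDifferential f p e)))]
  congr 1
  refine ContinuousLinearMap.ext fun u => ?_
  obtain ⟨u, rfl⟩ := surjective_chartDeriv he u
  rw [← chartMetric_apply, apply_inverse_apply (isInvertible_of_pos (chartMetric_pos hpos he)),
    chartDifferential_apply he (hf _)]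

theorem gradNormSq_extChartAt_symm (hpos : ∀ p v, v ≠ 0 → 0 < form g p v v) {f : M → ℝ}
    (hf : MDifferentiable 𝓘(ℝ, E) 𝓘(ℝ, ℝ) f) {p : M} {e : E}
    (he : e ∈ (extChartAt 𝓘(ℝ, E) p).target) :
    gradNormSq g f ((extChartAt 𝓘(ℝ, E) p).symm e) =
      chartMetric g p e ((chartMetric g p e).inverse (chartDifferential f p e))
        ((chartMetric g p e).inverse (chartDifferential f p e)) := by
  rw [chartMetric_apply, chartDeriv_inverse_chartDifferential hpos hf he, gradNormSq]

/-- The squared norm of the gradient in the preferred chart at `p`. -/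
def chartGradNormSq (g : MetricField 𝓘(ℝ, E) M) (f : M → ℝ) (p : M) (e : E) : ℝ :=
  chartMetric g p e ((chartMetric g p e).inverse (chartDifferential f p e))
    ((chartMetric g p e).inverse (chartDifferential f p e))

theorem gradNormSq_eventuallyEq (hpos : ∀ p v, v ≠ 0 → 0 < form g p v v) {f : M → ℝ}
    (hf : MDifferentiable 𝓘(ℝ, E) 𝓘(ℝ, ℝ) f) (p : M) :
    gradNormSq g f =ᶠ[nhds p] chartGradNormSq g f p ∘ extChartAt 𝓘(ℝ, E) p := by
  filter_upwards [extChartAt_source_mem_nhds (I := 𝓘(ℝ, E)) p] with m hm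
  have h := gradNormSq_extChartAt_symm hpos hf ((extChartAt 𝓘(ℝ, E) p).map_source hm)
  rw [(extChartAt 𝓘(ℝ, E) p).left_inv hm] at h
  exact h

theorem differentiableAt_inverse_chartDifferential (hpos : ∀ p v, v ≠ 0 → 0 < form g p v v)
    {f : M → ℝ} (hf : ContMDiff 𝓘(ℝ, E) 𝓘(ℝ, ℝ) ∞ f) {p : M} {e : E}
    (he : e ∈ (extChartAt 𝓘(ℝ, E) p).target) (hg : DifferentiableAt ℝ (chartMetric g p) e) :
    DifferentiableAt ℝ (fun x => (chartMetric g p x).inverse (chartDifferential f p x)) e :=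
  (differentiableAt_inverse hg (isInvertible_of_pos (chartMetric_pos hpos he))).clm_apply
    (differentiableAt_chartDifferential hf he)

theorem differentiableAt_chartGradNormSq (hpos : ∀ p v, v ≠ 0 → 0 < form g p v v)
    {f : M → ℝ} (hf : ContMDiff 𝓘(ℝ, E) 𝓘(ℝ, ℝ) ∞ f) {p : M} {e : E}
    (he : e ∈ (extChartAt 𝓘(ℝ, E) p).target) (hg : DifferentiableAt ℝ (chartMetric g p) e) :
    DifferentiableAt ℝ (chartGradNormSq g f p) e :=
  have hn := differentiableAt_inverse_chartDifferential hpos hf he hg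
  (hg.clm_apply hn).clm_apply hn

theorem fderiv_chartGradNormSq (hs : ∀ p v w, form g p v w = form g p w v)
    (hpos : ∀ p v, v ≠ 0 → 0 < form g p v v) {f : M → ℝ} (hf : ContMDiff 𝓘(ℝ, E) 𝓘(ℝ, ℝ) ∞ f)
    {p : M} (hg : DifferentiableAt ℝ (chartMetric g p) (extChartAt 𝓘(ℝ, E) p p)) (a : E) :
    fderiv ℝ (chartGradNormSq g f p) (extChartAt 𝓘(ℝ, E) p p) a =
      2 * covariantDerivative (christoffel g p) (chartDifferential f p) (extChartAt 𝓘(ℝ, E) p p) a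
        ((form g p).inverse (differential f p)) := by
  have hp := mem_extChartAt_target (I := 𝓘(ℝ, E)) p
  have h := fderiv_apply_inverse (Γ := christoffel g p) hg (chartMetric_pos hpos hp)
    (chartMetric_symm hs p _) (fderiv_chartMetric_symm hs hg) rfl
    (differentiableAt_chartDifferential hf hp)
    (differentiableAt_inverse_chartDifferential hpos hf hp hg) (by
      filter_upwards [(isOpen_extChartAt_target p).mem_nhds hp] with x hx
      rw [apply_inverse_apply (isInvertible_of_pos (chartMetric_pos hpos hx))]) a
  refine h.trans ?_
  rw [chartMetric_self, chartDifferential_self (hf.mdifferentiable (by simp) p)]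

theorem gradNormSq_hasDifferential (hpos : ∀ p v, v ≠ 0 → 0 < form g p v v)
    {f : M → ℝ} (hf : ContMDiff 𝓘(ℝ, E) 𝓘(ℝ, ℝ) ∞ f) {p : M}
    (hg : DifferentiableAt ℝ (chartMetric g p) (extChartAt 𝓘(ℝ, E) p p)) :
    MDifferentiableAt 𝓘(ℝ, E) 𝓘(ℝ, ℝ) (gradNormSq g f) p ∧
      differential (gradNormSq g f) p =
        fderiv ℝ (chartGradNormSq g f p) (extChartAt 𝓘(ℝ, E) p p) :=
  differential_of_eventuallyEq_comp_extChartAt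
    (differentiableAt_chartGradNormSq hpos hf (mem_extChartAt_target p) hg)
    (gradNormSq_eventuallyEq hpos (hf.mdifferentiable (by simp)) p)

theorem gradNorm_hasDifferential (hpos : ∀ p v, v ≠ 0 → 0 < form g p v v)
    {f : M → ℝ} (hf : ContMDiff 𝓘(ℝ, E) 𝓘(ℝ, ℝ) ∞ f) {p : M}
    (hg : DifferentiableAt ℝ (chartMetric g p) (extChartAt 𝓘(ℝ, E) p p))
    (h0 : gradNormSq g f p ≠ 0) :
    MDifferentiableAt 𝓘(ℝ, E) 𝓘(ℝ, ℝ) (gradNorm g f) p ∧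
      differential (gradNorm g f) p = (1 / (2 * gradNorm g f p)) •
        fderiv ℝ (chartGradNormSq g f p) (extChartAt 𝓘(ℝ, E) p p) := by
  have hd := differentiableAt_chartGradNormSq hpos hf (mem_extChartAt_target p) hg
  have heq := gradNormSq_eventuallyEq hpos (hf.mdifferentiable (by simp)) p
  have h0' : chartGradNormSq g f p (extChartAt 𝓘(ℝ, E) p p) ≠ 0 := by
    rwa [heq.eq_of_nhds] at h0
  have hsq := hd.hasFDerivAt.sqrt h0'
  have h := differential_of_eventuallyEq_comp_extChartAt (h := gradNorm g f) hsq.differentiableAt (by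
    filter_upwards [heq] with m hm
    rw [gradNorm_eq_sqrt, hm]
    rfl)
  refine ⟨h.1, h.2.trans ?_⟩
  rw [hsq.fderiv, gradNorm_eq_sqrt, heq.eq_of_nhds]
  rfl

end Gradient

section Identity

variable {E : Type*} [NormedAddCommGroup E] [NormedSpace ℝ E]
  {H : Type*} [TopologicalSpace H] {I : ModelWithCorners ℝ E H} [I.Boundaryless]
  {M : Type*} [TopologicalSpace M] [ChartedSpace H M]

theorem secondFundamentalForm_id (G K : MetricField I M) (p : M) (v w : E) :
    (secondFundamentalForm G K (id : M → M) p v w : E) =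
      localChristoffel (chartMetric K p) (extChartAt I p p) v w
        - localChristoffel (chartMetric G p) (extChartAt I p p) v w := by
  have heq : writtenInExtChartAt I I p (id : M → M) =ᶠ[nhds (extChartAt I p p)] id := by
    filter_upwards [(isOpen_extChartAt_target p).mem_nhds (mem_extChartAt_target p)] with x hx
      using (extChartAt I p).right_inv hx
  have h1 : fderiv ℝ (writtenInExtChartAt I I p (id : M → M)) =ᶠ[nhds (extChartAt I p p)]
      fun _ => ContinuousLinearMap.id ℝ E := by
    filter_upwards [heq.eventuallyEq_nhds] with x hx
    rw [hx.fderiv_eq, fderiv_id]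
  have h2 : fderiv ℝ (fderiv ℝ (writtenInExtChartAt I I p (id : M → M))) (extChartAt I p p) = 0 := by
    rw [h1.fderiv_eq]
    exact fderiv_const_apply _
  have h : (secondFundamentalForm G K (id : M → M) p v w : E) =
      fderiv ℝ (fderiv ℝ (writtenInExtChartAt I I p (id : M → M))) (extChartAt I p p) v w
        - fderiv ℝ (writtenInExtChartAt I I p (id : M → M)) (extChartAt I p p)
          (localChristoffel (chartMetric G p) (extChartAt I p p) v w)
        + localChristoffel (chartMetric K p) (extChartAt I p p)
          (fderiv ℝ (writtenInExtChartAt I I p (id : M → M)) (extChartAt I p p) v)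
          (fderiv ℝ (writtenInExtChartAt I I p (id : M → M)) (extChartAt I p p) w) := rfl
  rw [h, h2, h1.eq_of_nhds]
  simp only [zero_apply, ContinuousLinearMap.id_apply]
  abel

theorem tension_id [FiniteDimensional ℝ E] (G K : MetricField I M) (p : M) :
    (tension G K (id : M → M) p : E) = ∑ i,
      (localChristoffel (chartMetric K p) (extChartAt I p p) (Module.finBasis ℝ E i)
          ((form G p).inverse
            (LinearMap.toContinuousLinearMap ((Module.finBasis ℝ E).coord i) : E →L[ℝ] ℝ))
        - localChristoffel (chartMetric G p) (extChartAt I p p) (Module.finBasis ℝ E i)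
          ((form G p).inverse
            (LinearMap.toContinuousLinearMap ((Module.finBasis ℝ E).coord i) : E →L[ℝ] ℝ))) := by
  refine Finset.sum_congr rfl fun i _ => ?_
  exact secondFundamentalForm_id G K p _ _

end Identity

section Tension

variable {E : Type*} [NormedAddCommGroup E] [NormedSpace ℝ E]
  {M : Type*} [TopologicalSpace M] [ChartedSpace E M] [IsManifold 𝓘(ℝ, E) ∞ M]

/-- A function with vanishing differential is locally constant. -/
theorem isLocallyConstant_of_differential_eq_zero {h : M → ℝ}
    (hd : MDifferentiable 𝓘(ℝ, E) 𝓘(ℝ, ℝ) h) (h0 : ∀ p, (differential h p : E →L[ℝ] ℝ) = 0) :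
    IsLocallyConstant h := by
  rw [IsLocallyConstant.iff_eventually_eq]
  intro p
  obtain ⟨r, hr, hball⟩ := Metric.isOpen_iff.1 (isOpen_extChartAt_target (I := 𝓘(ℝ, E)) p) _
    (mem_extChartAt_target p)
  have hfd : ∀ e ∈ Metric.ball (extChartAt 𝓘(ℝ, E) p p) r,
      HasFDerivAt (h ∘ (extChartAt 𝓘(ℝ, E) p).symm) (0 : E →L[ℝ] ℝ) e := by
    intro e he
    have hdiff : DifferentiableAt ℝ (h ∘ (extChartAt 𝓘(ℝ, E) p).symm) e :=
      ((hd _).comp e (mdifferentiableAt_extChartAt_symm (hball he))).differentiableAt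
    convert hdiff.hasFDerivAt
    refine ContinuousLinearMap.ext fun v => ?_
    refine Eq.trans ?_ (chartDifferential_apply (hball he) (hd _) v).symm
    rw [h0]
    rfl
  have hev := (continuousAt_extChartAt (I := 𝓘(ℝ, E)) p).eventually (Metric.ball_mem_nhds _ hr)
  filter_upwards [hev, extChartAt_source_mem_nhds (I := 𝓘(ℝ, E)) p] with q hq hqs
  have h := (convex_ball (extChartAt 𝓘(ℝ, E) p p) r).is_const_of_fderivWithin_eq_zero (𝕜 := ℝ)
    (fun e he => (hfd e he).differentiableAt.differentiableWithinAt)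
    (fun e he => (hfd e he).hasFDerivWithinAt.fderivWithin
      (Metric.isOpen_ball.uniqueDiffWithinAt he)) hq (Metric.mem_ball_self hr)
  simpa only [Function.comp_apply, (extChartAt 𝓘(ℝ, E) p).left_inv hqs, extChartAt_to_inv] using h

variable {g : MetricField 𝓘(ℝ, E) M}

theorem form_musGradient_pos (hpos : ∀ p v, v ≠ 0 → 0 < form g p v v) (f : M → ℝ)
    (P : TangentBundle 𝓘(ℝ, E) M) (v : E × E) (hv : v ≠ 0) : 0 < form (musGradient g f) P v v :=
  localMusGradient_pos (B := fun _ => form g P.proj)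
    (Γ := fun _ => christoffel g P.proj (extChartAt 𝓘(ℝ, E) P.proj P.proj))
    (η := fun _ => differential f P.proj) (z := ((0 : E), (P.2 : E))) (hpos _) v hv

/-- The right-hand side of the tension field formula, as a covector. -/
theorem form_musGradient_horizontalLift (f : M → ℝ) (P : TangentBundle 𝓘(ℝ, E) M) (a : E)
    (ζ : E × E) :
    form (musGradient g f) P (horizontalLift g P a : E × E) ζ = form g P.proj a ζ.1 := by
  have key : ∀ X : E × E, X.1 = a → (verticalPart g P X : E) = 0 →
      form (musGradient g f) P X ζ = form g P.proj a ζ.1 := by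
    intro X h1 h2
    rw [form_musGradient, form_sasaki, h2]
    simp only [map_zero, zero_apply, zero_mul, add_zero]
    rw [← h1]
    rfl
  exact key _ rfl (verticalPart_horizontalLift g P a)

theorem eq_of_forall_form_eq {A : (E × E) →L[ℝ] (E × E) →L[ℝ] ℝ} (hA : A.IsInvertible) {X Y : E × E}
    (h : ∀ ζ, A X ζ = A Y ζ) : X = Y := by
  rw [← inverse_apply_apply hA X, ← inverse_apply_apply hA Y, ContinuousLinearMap.ext h]

variable [FiniteDimensional ℝ E]

/-- The tension field of the identity map from the Mus-Gradient metric to the Sasaki metric, as a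
covector. -/
theorem form_musGradient_tension (hs : ∀ p v w, form g p v w = form g p w v)
    (hpos : ∀ p v, v ≠ 0 → 0 < form g p v v)
    (hg : ∀ p, ContDiffOn ℝ ∞ (chartMetric g p) (extChartAt 𝓘(ℝ, E) p).target)
    {f : M → ℝ} (hf : ContMDiff 𝓘(ℝ, E) 𝓘(ℝ, ℝ) ∞ f) (P : TangentBundle 𝓘(ℝ, E) M) (ζ : E × E) :
    form (musGradient g f) P
        (tension (musGradient g f) (sasaki g) (id : TangentBundle 𝓘(ℝ, E) M → _) P : E × E) ζ =
      covariantDerivative (christoffel g P.proj) (chartDifferential f P.proj)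
        (extChartAt 𝓘(ℝ, E) P.proj P.proj) ζ.1
        ((form g P.proj).inverse (differential f P.proj)) / (1 + gradNormSq g f P.proj) := by
  have hc : ∀ p, ∀ e ∈ (extChartAt 𝓘(ℝ, E) p).target, ContDiffAt ℝ ∞ (chartMetric g p) e :=
    fun p e he => (hg p).contDiffAt ((isOpen_extChartAt_target p).mem_nhds he)
  have hdiff : ∀ p, ∀ e ∈ (extChartAt 𝓘(ℝ, E) p).target, DifferentiableAt ℝ (chartMetric g p) e :=
    fun p e he => (hc p e he).differentiableAt (by simp)
  have hmd : MDifferentiable 𝓘(ℝ, E) 𝓘(ℝ, ℝ) f := hf.mdifferentiable (by simp)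
  have hp := mem_extChartAt_target (I := 𝓘(ℝ, E)) P.proj
  obtain ⟨z, hz⟩ : ∃ z : E × E, z = extChartAt 𝓘(ℝ, E).tangent P P := ⟨_, rfl⟩
  have hz1 : z.1 = extChartAt 𝓘(ℝ, E) P.proj P.proj := by rw [hz]; rfl
  have hzt : ∀ᶠ x : E × E in nhds z, x.1 ∈ (extChartAt 𝓘(ℝ, E) P.proj).target := by
    refine continuousAt_fst.eventually (Filter.eventually_mem_set.2
      ((isOpen_extChartAt_target P.proj).mem_nhds ?_))
    rw [hz1]
    exact hp
  have hS : chartMetric (sasaki g) P =ᶠ[nhds z]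
      localSasaki (chartMetric g P.proj) (christoffel g P.proj) := by
    filter_upwards [hzt] with x hx using chartMetric_sasaki hs hpos hdiff hx
  have hG : chartMetric (musGradient g f) P =ᶠ[nhds z]
      localMusGradient (chartMetric g P.proj) (christoffel g P.proj)
        (chartDifferential f P.proj) := by
    filter_upwards [hzt] with x hx using chartMetric_musGradient hs hpos hdiff hmd hx
  have hself : form (musGradient g f) P = localMusGradient (chartMetric g P.proj)
      (christoffel g P.proj) (chartDifferential f P.proj) z := by
    rw [← hG.eq_of_nhds, hz, chartMetric_self]
  have hpos' := chartMetric_pos hpos (hz1 ▸ hp : z.1 ∈ (extChartAt 𝓘(ℝ, E) P.proj).target)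
  have hdz : DifferentiableAt ℝ (chartMetric g P.proj) z.1 := by
    rw [hz1]
    exact hdiff _ _ hp
  have h := localMusGradient_sum_christoffel_sub (Γ := christoffel g P.proj)
    (η := chartDifferential f P.proj) (Module.finBasis ℝ (E × E)) hdz hpos'
    (chartMetric_symm hs P.proj _) (fderiv_chartMetric_symm hs hdz)
    (by
      rw [hz1]
      exact differentiableAt_localChristoffel (contDiffAt_infty.1 (hc _ _ hp) 2)
        (isInvertible_of_pos (chartMetric_pos hpos hp))) rfl
    (by
      rw [hz1]
      exact differentiableAt_chartDifferential hf hp) ζ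
  rw [← localChristoffel_congr hS, ← localChristoffel_congr hG, ← hself, hz1, chartMetric_self,
    chartDifferential_self (hmd _), ← gradNormSq_eq hpos, hz] at h
  rw [← h]
  exact congrArg (fun X => form (musGradient g f) P X ζ) (tension_id (musGradient g f) (sasaki g) P)

theorem covariantDerivative_eq (hs : ∀ p v w, form g p v w = form g p w v)
    (hpos : ∀ p v, v ≠ 0 → 0 < form g p v v) {f : M → ℝ} (hf : ContMDiff 𝓘(ℝ, E) 𝓘(ℝ, ℝ) ∞ f)
    {p : M} (hg : DifferentiableAt ℝ (chartMetric g p) (extChartAt 𝓘(ℝ, E) p p)) (a : E) :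
    covariantDerivative (christoffel g p) (chartDifferential f p) (extChartAt 𝓘(ℝ, E) p p) a
        ((form g p).inverse (differential f p)) =
      gradNorm g f p * differential (gradNorm g f) p a := by
  by_cases h0 : gradNormSq g f p = 0
  · have hn : (form g p).inverse (differential f p) = 0 := by
      by_contra hne
      exact (hpos _ _ hne).ne' h0
    rw [hn, gradNorm_eq_sqrt, h0]
    simp
  · have hne : gradNorm g f p ≠ 0 := by
      rw [gradNorm_eq_sqrt]
      exact (Real.sqrt_pos.2 (lt_of_le_of_ne (gradNormSq_nonneg hpos f p) (Ne.symm h0))).ne'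
    rw [(gradNorm_hasDifferential hpos hf hg h0).2, smul_apply, fderiv_chartGradNormSq hs hpos hf hg,
      smul_eq_mul]
    field_simp

theorem tension_musGradient_sasaki (hs : ∀ p v w, form g p v w = form g p w v)
    (hpos : ∀ p v, v ≠ 0 → 0 < form g p v v)
    (hg : ∀ p, ContDiffOn ℝ ∞ (chartMetric g p) (extChartAt 𝓘(ℝ, E) p).target)
    {f : M → ℝ} (hf : ContMDiff 𝓘(ℝ, E) 𝓘(ℝ, ℝ) ∞ f) (P : TangentBundle 𝓘(ℝ, E) M) :
    (tension (musGradient g f) (sasaki g) (id : TangentBundle 𝓘(ℝ, E) M → _) P : E × E) =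
      (gradNorm g f P.proj / (1 + gradNorm g f P.proj ^ 2)) •
        (horizontalLift g P (grad g (gradNorm g f) P.proj) : E × E) := by
  have hd : DifferentiableAt ℝ (chartMetric g P.proj) (extChartAt 𝓘(ℝ, E) P.proj P.proj) :=
    ((hg P.proj).contDiffAt ((isOpen_extChartAt_target _).mem_nhds
      (mem_extChartAt_target P.proj))).differentiableAt (by simp)
  have hGi := isInvertible_of_pos (form_musGradient_pos hpos f P)
  refine eq_of_forall_form_eq hGi fun ζ => ?_
  have hgr : form g P.proj (grad g (gradNorm g f) P.proj : E) = differential (gradNorm g f) P.proj :=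
    apply_inverse_apply (isInvertible_of_pos (hpos P.proj)) _
  have hsmul : ∀ (c : ℝ) (X : E × E), form (musGradient g f) P (c • X) ζ =
      c * form (musGradient g f) P X ζ := fun c X => by
    rw [map_smul, smul_apply, smul_eq_mul]
  refine ((form_musGradient_tension hs hpos hg hf P ζ).trans ?_).trans (hsmul _ _).symm
  refine Eq.trans ?_ (congrArg _ (form_musGradient_horizontalLift f P _ ζ)).symm
  rw [hgr, covariantDerivative_eq hs hpos hf hd, gradNorm_eq_sqrt,
    Real.sq_sqrt (gradNormSq_nonneg hpos f _)]
  ring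

theorem isHarmonic_id_iff [PreconnectedSpace M] (hs : ∀ p v w, form g p v w = form g p w v)
    (hpos : ∀ p v, v ≠ 0 → 0 < form g p v v)
    (hg : ∀ p, ContDiffOn ℝ ∞ (chartMetric g p) (extChartAt 𝓘(ℝ, E) p).target)
    {f : M → ℝ} (hf : ContMDiff 𝓘(ℝ, E) 𝓘(ℝ, ℝ) ∞ f) :
    IsHarmonic (musGradient g f) (sasaki g) (id : TangentBundle 𝓘(ℝ, E) M → _) ↔
      ∃ c : ℝ, ∀ x, gradNorm g f x = c := by
  have hd : ∀ p, DifferentiableAt ℝ (chartMetric g p) (extChartAt 𝓘(ℝ, E) p p) := fun p =>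
    ((hg p).contDiffAt ((isOpen_extChartAt_target _).mem_nhds
      (mem_extChartAt_target p))).differentiableAt (by simp)
  constructor
  · rintro ⟨-, hτ⟩
    have hloc : IsLocallyConstant (gradNormSq g f) := by
      refine isLocallyConstant_of_differential_eq_zero
        (fun p => (gradNormSq_hasDifferential hpos hf (hd p)).1) fun p => ?_
      rw [(gradNormSq_hasDifferential hpos hf (hd p)).2]
      refine ContinuousLinearMap.ext fun a => ?_
      rw [fderiv_chartGradNormSq hs hpos hf (hd p)]
      obtain ⟨P, rfl⟩ : ∃ P : TangentBundle 𝓘(ℝ, E) M, P.proj = p := ⟨⟨p, (0 : E)⟩, rfl⟩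
      have h := form_musGradient_tension hs hpos hg hf P (a, 0)
      have hzero : ∀ X : E × E, X = 0 → form (musGradient g f) P X (a, 0) = 0 := by
        rintro X rfl
        rw [map_zero, zero_apply]
      have hne : 1 + gradNormSq g f P.proj ≠ 0 := by linarith [gradNormSq_nonneg hpos f P.proj]
      replace h := h.symm.trans (hzero _ (hτ P))
      rw [div_eq_zero_iff, or_iff_left hne] at h
      rw [h, mul_zero, zero_apply]
    rcases isEmpty_or_nonempty M with _ | ⟨⟨p⟩⟩
    · exact ⟨0, fun x => isEmptyElim x⟩
    · refine ⟨gradNorm g f p, fun x => ?_⟩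
      rw [gradNorm_eq_sqrt, gradNorm_eq_sqrt, hloc.apply_eq_of_preconnectedSpace x p]
  · rintro ⟨c, hc⟩
    refine ⟨contMDiff_id, fun P => ?_⟩
    refine (tension_musGradient_sasaki hs hpos hg hf P).trans ?_
    have hconst : gradNorm g f = fun _ => c := funext hc
    have hgr : (grad g (gradNorm g f) P.proj : E) = 0 := by
      have h0 : (differential (gradNorm g f) P.proj : E →L[ℝ] ℝ) = 0 := by
        rw [hconst]
        exact mfderiv_const
      have h1 : (grad g (gradNorm g f) P.proj : E) =
        (form g P.proj).inverse (differential (gradNorm g f) P.proj) := rfl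
      exact h1.trans ((congrArg _ h0).trans (map_zero _))
    have hlift : (horizontalLift g P (0 : E) : E × E) = 0 := by
      refine Prod.ext rfl ?_
      change -(christoffel g P.proj (extChartAt 𝓘(ℝ, E) P.proj P.proj) (0 : E) (P.2 : E)) = (0 : E)
      rw [map_zero]
      exact neg_zero
    rw [show (horizontalLift g P (grad g (gradNorm g f) P.proj) : E × E) = 0 from
      (congrArg (fun a : E => (horizontalLift g P a : E × E)) hgr).trans hlift, smul_zero]

end Tension

end MusGradient

end

theorem theorem4p3 {E : Type*} [NormedAddCommGroup E] [NormedSpace ℝ E] [FiniteDimensional ℝ E]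
    {M : Type*} [TopologicalSpace M] [ChartedSpace E M] [IsManifold 𝓘(ℝ, E) ∞ M]
    (g : ContMDiffRiemannianMetric 𝓘(ℝ, E) ∞ E (fun x : M => TangentSpace 𝓘(ℝ, E) x))
    (hflat : MusGradient.IsFlat (I := 𝓘(ℝ, E)) g.inner)
    (f : M → ℝ) (hf : ContMDiff 𝓘(ℝ, E) 𝓘(ℝ, ℝ) ∞ f) (hpos : ∀ x, 0 < f x) :
    (∀ x, MusGradient.grad (I := 𝓘(ℝ, E)) g.inner f x ≠ 0 →
      MDifferentiableAt 𝓘(ℝ, E) 𝓘(ℝ, ℝ) (MusGradient.gradNorm (I := 𝓘(ℝ, E)) g.inner f) x) ∧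
    (∀ p : TangentBundle 𝓘(ℝ, E) M,
      MusGradient.tension (MusGradient.musGradient g.inner f) (MusGradient.sasaki g.inner)
          (id : TangentBundle 𝓘(ℝ, E) M → TangentBundle 𝓘(ℝ, E) M) p =
        (MusGradient.gradNorm (I := 𝓘(ℝ, E)) g.inner f p.proj
            / (1 + MusGradient.gradNorm (I := 𝓘(ℝ, E)) g.inner f p.proj ^ 2)) •
          MusGradient.horizontalLift g.inner p
            (MusGradient.grad (I := 𝓘(ℝ, E)) g.inner
              (MusGradient.gradNorm (I := 𝓘(ℝ, E)) g.inner f) p.proj)) ∧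
    (PreconnectedSpace M →
      (MusGradient.IsHarmonic (MusGradient.musGradient g.inner f) (MusGradient.sasaki g.inner)
          (id : TangentBundle 𝓘(ℝ, E) M → TangentBundle 𝓘(ℝ, E) M) ↔
        ∃ c : ℝ, ∀ x, MusGradient.gradNorm (I := 𝓘(ℝ, E)) g.inner f x = c)) := by

  have hs : ∀ p v w, MusGradient.form (I := 𝓘(ℝ, E)) g.inner p v w =
    MusGradient.form (I := 𝓘(ℝ, E)) g.inner p w v := g.symm
  have hp : ∀ p v, v ≠ 0 → 0 < MusGradient.form (I := 𝓘(ℝ, E)) g.inner p v v := g.pos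
  have hg := MusGradient.contDiffOn_chartMetric g
  refine ⟨fun x hx => ?_, fun p => MusGradient.tension_musGradient_sasaki hs hp hg hf p, fun _ =>
    MusGradient.isHarmonic_id_iff hs hp hg hf⟩
  refine (MusGradient.gradNorm_hasDifferential hp hf (((hg x).contDiffAt
    ((isOpen_extChartAt_target x).mem_nhds (mem_extChartAt_target x))).differentiableAt (by simp))
    (hp x _ hx).ne').1
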